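/- Let $k\ge 1$ and let $Q$ be a (real, Hausdorff, paracompact, connected, $C^\infty$) manifold of dimension $n$. Let $T^1_kQ=TQ\oplus\cdots\oplus TQ$ and $(T^1_k)^*Q=T^*Q\oplus\cdots\oplus T^*Q$ be the Whitney sums of $k$ copies, with induced coordinates $(q^i,v^i_A)$ and $(q^i,p^A_i)$. Let $(\omega_0)_A=-d(\theta_0)_A$, where $(\theta_0)_A=p^A_i\,dq^i$ is the pull-back of the Liouville form of $T^*Q$ under the $A$-th projection $(T^1_k)^*Q\to T^*Q$. Let $L:T^1_kQ\to\mathbb R$ be a smooth regular Lagrangian, i.e. $\det\big(\partial^2L/\partial v^i_A\partial v^j_B\big)\ne0$ everywhere. Let $FL:T^1_kQ\to(T^1_k)^*Q$ be its Legendre map, $[FL(v_1,\dots,v_k)]^A(w)=\frac{d}{ds}\big|_{s=0}L(v_1,\dots,v_A+sw,\dots,v_k)$, let $E_L=C(L)-L$ with $C$ the generator of the flow $(s,v)\mapsto e^sv$, and let $(\omega_L)_A=-d(dL\circ S^A)$, where $S^A$ is the canonical $(1,1)$-tensor $\partial/\partial v^i_A\otimes dq^i$. A (local) $k$-vector field $X=(X_1,\dots,X_k)$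 is a family of $k$ smooth (local) vector fields; it is integrable if through every point $x$ of its domain there passes an integral section, i.e. a smooth map $\psi$ from an open neighbourhood of $0\in\mathbb R^k$ into the domain with $\psi(0)=x$ and $\psi_*(t)(\partial/\partial t^A)=X_A(\psi(t))$ for all $t$ and $A$. Consider the equations $$(\mathrm{L})\ \sum_A i_{X_A}(\omega_L)_A=dE_L\ \text{ on } T^1_kQ,\qquad (\mathrm{H})\ \sum_A i_{X_A}(\omega_0)_A=dH\ \text{ on } (T^1_k)^*Q,\qquad (\mathrm{U})\ \sum_A i_{Z_A}\Omega_A=d\mathcal H\ \text{ on } T^1_kQ\oplus_Q(T^1_k)^*Q,$$ where $\mathrm{pr}_1,\mathrm{pr}_2$ are the projections of the Whitney sum $T^1_kQ\oplus_Q(T^1_k)^*Q$, $\Omega_A=\mathrm{pr}_2^*(\omega_0)_A$ and $\mathcal H(v,\alpha)=\sum_A\alpha^A(v_A)-L(v)$. Let $M_L=\{(v,FL(v))\}$ be the graph of $FL$. A solution $Z$ of (U) over an open $U\subseteq T^1_kQ$ is a $k$-vector field on $M_L\cap\mathrm{pr}_1^{-1}(U)$, tangent to $M_L$, satisfying (U)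 at the points of $M_L\cap\mathrm{pr}_1^{-1}(U)$ as an equality of covectors of the whole Whitney sum. Then every point of $T^1_kQ$ has an open neighbourhood $U$ such that $FL|_U$ is a diffeomorphism onto an open set and (L) has a solution on $U$. Moreover, let $U\subseteq T^1_kQ$ be any open set such that $FL|_U$ is a diffeomorphism onto an open set $V\subseteq(T^1_k)^*Q$, and let $H$ be defined on $V$ by $H\circ FL=E_L$ on $U$. Then $H$ is smooth on $V$ and: 1. For every solution $X_L$ of (L) on $U$, the $k$-vector field $X_H$ on $V$ defined by $X_H\circ FL=T^1_k(FL)\circ X_L$, i.e. $(X_H)_A(FL(v))=FL_*(v)\big((X_L)_A(v)\big)$, is a (smooth) solution of (H) on $V$. 2. For every integrable solution $X_H$ of (H) on $V$ there is an integrable solution $Z$ of (U) over $U$ from which $X_H$ is recovered as in 1: the $k$-vector field $X_L$ on $U$ defined by $X_L\circ\mathrm{pr}_1=T^1_k(\mathrm{pr}_1)\circ Z$ on $M_L\cap\mathrm{pr}_1^{-1}(U)$ is a solution of (L) on $U$, and $X_H\circ FL=T^1_k(FL)\circ X_L$ on $U$. -/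

import Mathlib

open Bundle Set
open scoped Manifold ContDiff

noncomputable section

namespace KSymplectic

/-! ### Forms and `k`-vector fields on a manifold -/

section General

variable {E : Type*} [NormedAddCommGroup E] [NormedSpace ℝ E]
  {H : Type*} [TopologicalSpace H] (I : ModelWithCorners ℝ E H)
  {M : Type*} [TopologicalSpace M] [ChartedSpace H M]

/-- The exterior derivative of a 1-form on a manifold without boundary: at `x`, write the form in
the chart around `x`, take the exterior derivative in the model vector space, and transport the
result back. The convention is `dθ (X, Y) = X (θ Y) - Y (θ X) - θ [X, Y]`. -/
def extDerivOneForm (θ : ∀ x : M, TangentSpace I x →L[ℝ] ℝ) (x : M) :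
    TangentSpace I x [⋀^Fin 2]→L[ℝ] ℝ :=
  (extDeriv (fun y : E => ContinuousAlternatingMap.ofSubsingleton ℝ E ℝ (0 : Fin 1)
      ((θ ((extChartAt I x).symm y)).comp (mfderiv 𝓘(ℝ, E) I (extChartAt I x).symm y)))
    (extChartAt I x x)).compContinuousLinearMap (mfderiv I 𝓘(ℝ, E) (extChartAt I x) x)

variable (M) in
/-- A family of `k` vector fields `X₁, …, X_k`; smoothness is the predicate `IsSmoothOn`. -/
abbrev KVectorField (k : ℕ) : Type _ := Fin k → ∀ x : M, TangentSpace I x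

/-- Each `X_A` is smooth on the set `S`, as a map into the tangent bundle. -/
def IsSmoothOn [IsManifold I ∞ M] {k : ℕ} (X : KVectorField I M k) (S : Set M) : Prop :=
  ∀ A, ContMDiffOn I I.tangent ∞ (fun x => (⟨x, X A x⟩ : TangentBundle I M)) S

/-- `∑_A i_{X_A} w_A = dh` at all points of `S`, as an equality of covectors of `M`. -/
def SolvesOn {k : ℕ} (w : Fin k → ∀ x : M, TangentSpace I x [⋀^Fin 2]→L[ℝ] ℝ) (h : M → ℝ)
    (X : KVectorField I M k) (S : Set M) : Prop :=
  ∀ x ∈ S, ∀ Y : TangentSpace I x,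
    ∑ A, w A x ![X A x, Y] = mfderiv I 𝓘(ℝ, ℝ) h x Y

/-- `ψ : U₀ ⊆ ℝᵏ → S` is an integral section of `X` through `x`. -/
structure IsIntegralSection {k : ℕ} (X : KVectorField I M k) (S : Set M)
    (U₀ : Set (Fin k → ℝ)) (ψ : (Fin k → ℝ) → M) (x : M) : Prop where
  isOpen : IsOpen U₀
  zero_mem : (0 : Fin k → ℝ) ∈ U₀
  map_zero : ψ 0 = x
  smooth : ContMDiffOn 𝓘(ℝ, Fin k → ℝ) I ∞ ψ U₀
  mapsTo : MapsTo ψ U₀ S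
  deriv_eq : ∀ t ∈ U₀, ∀ A : Fin k,
    mfderiv 𝓘(ℝ, Fin k → ℝ) I ψ t (Pi.single A 1 : Fin k → ℝ) = X A (ψ t)

/-- Through each point of `S` passes an integral section of `X` with values in `S`. -/
def IsIntegrableOn {k : ℕ} (X : KVectorField I M k) (S : Set M) : Prop :=
  ∀ x ∈ S, ∃ U₀ ψ, IsIntegralSection I X S U₀ ψ x

end General

/-! ### The bundles `T¹ₖQ`, `(T¹ₖ)*Q` and their Whitney sum -/

/-- The model space `ℝⁿ`. -/
abbrev Mdl (n : ℕ) : Type := EuclideanSpace ℝ (Fin n)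

theorem contMDiffOn_of_linear {n : ℕ} {Q : Type*} [TopologicalSpace Q] [ChartedSpace (Mdl n) Q]
    {F : Type*} [NormedAddCommGroup F] [NormedSpace ℝ F]
    (φ : (Mdl n →L[ℝ] Mdl n) → (F →L[ℝ] F)) (hadd : ∀ S T, φ (S + T) = φ S + φ T)
    (hsmul : ∀ (c : ℝ) T, φ (c • T) = c • φ T) {f : Q → (Mdl n →L[ℝ] Mdl n)} {s : Set Q}
    (hf : ContMDiffOn (𝓡 n) 𝓘(ℝ, Mdl n →L[ℝ] Mdl n) ∞ f s) :
    ContMDiffOn (𝓡 n) 𝓘(ℝ, F →L[ℝ] F) ∞ (fun x => φ (f x)) s :=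
  (LinearMap.toContinuousLinearMap
    ({ toFun := φ, map_add' := hadd, map_smul' := hsmul } :
      (Mdl n →L[ℝ] Mdl n) →ₗ[ℝ] (F →L[ℝ] F))).contMDiff.comp_contMDiffOn hf

section Bundles

variable (n k : ℕ) (Q : Type*) [TopologicalSpace Q] [ChartedSpace (Mdl n) Q]

/-- The fibre of `T¹ₖQ = TQ ⊕ ⋯ ⊕ TQ` at `q`: `k`-tuples of tangent vectors at `q`. -/
def VelFiber (q : Q) : Type := Fin k → TangentSpace (𝓡 n) q

/-- The fibre of `(T¹ₖ)*Q = T*Q ⊕ ⋯ ⊕ T*Q` at `q`: `k`-tuples of covectors at `q`. -/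
def CovFiber (q : Q) : Type := Fin k → (TangentSpace (𝓡 n) q →L[ℝ] ℝ)

instance (q : Q) : AddCommGroup (VelFiber n k Q q) := inferInstanceAs <|
  AddCommGroup (Fin k → Mdl n)
instance (q : Q) : Module ℝ (VelFiber n k Q q) := inferInstanceAs <|
  Module ℝ (Fin k → Mdl n)
instance (q : Q) : TopologicalSpace (VelFiber n k Q q) := inferInstanceAs <|
  TopologicalSpace (Fin k → Mdl n)
instance (q : Q) : AddCommGroup (CovFiber n k Q q) := inferInstanceAs <|
  AddCommGroup (Fin k → (Mdl n →L[ℝ] ℝ))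
instance (q : Q) : Module ℝ (CovFiber n k Q q) := inferInstanceAs <|
  Module ℝ (Fin k → (Mdl n →L[ℝ] ℝ))
instance (q : Q) : TopologicalSpace (CovFiber n k Q q) := inferInstanceAs <|
  TopologicalSpace (Fin k → (Mdl n →L[ℝ] ℝ))

variable [IsManifold (𝓡 n) ∞ Q]

/-- The bundle structure of `T¹ₖQ`: a change of chart of `Q` acts on each of the `k` tangent
vectors as in the tangent bundle. -/
def velCore : VectorBundleCore ℝ Q (Fin k → Mdl n) (atlas (Mdl n) Q) where
  baseSet := (tangentBundleCore (𝓡 n) Q).baseSet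
  isOpen_baseSet := (tangentBundleCore (𝓡 n) Q).isOpen_baseSet
  indexAt := (tangentBundleCore (𝓡 n) Q).indexAt
  mem_baseSet_at := (tangentBundleCore (𝓡 n) Q).mem_baseSet_at
  coordChange i j x := ContinuousLinearMap.pi fun A =>
    ((tangentBundleCore (𝓡 n) Q).coordChange i j x).comp (ContinuousLinearMap.proj A)
  coordChange_self i x hx v := by
    funext A
    exact (tangentBundleCore (𝓡 n) Q).coordChange_self i x hx (v A)
  continuousOn_coordChange i j := by
    rw [continuousOn_clm_apply]
    intro v
    refine continuousOn_pi.2 fun A => ?_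
    exact ((tangentBundleCore (𝓡 n) Q).continuousOn_coordChange i j).clm_apply
      continuousOn_const
  coordChange_comp i j l x hx v := by
    funext A
    exact (tangentBundleCore (𝓡 n) Q).coordChange_comp i j l x hx (v A)

/-- The bundle structure of `(T¹ₖ)*Q`: a change of chart of `Q` acts on each of the `k` covectors
by the transposed inverse of its action on tangent vectors. -/
def covCore : VectorBundleCore ℝ Q (Fin k → (Mdl n →L[ℝ] ℝ)) (atlas (Mdl n) Q) where
  baseSet := (tangentBundleCore (𝓡 n) Q).baseSet
  isOpen_baseSet := (tangentBundleCore (𝓡 n) Q).isOpen_baseSet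
  indexAt := (tangentBundleCore (𝓡 n) Q).indexAt
  mem_baseSet_at := (tangentBundleCore (𝓡 n) Q).mem_baseSet_at
  coordChange i j x := ContinuousLinearMap.pi fun A =>
    (ContinuousLinearMap.precomp ℝ ((tangentBundleCore (𝓡 n) Q).coordChange j i x)).comp
      (ContinuousLinearMap.proj A)
  coordChange_self i x hx α := by
    funext A
    ext w
    exact congrArg (α A) ((tangentBundleCore (𝓡 n) Q).coordChange_self i x hx w)
  continuousOn_coordChange i j := by
    rw [continuousOn_clm_apply]
    intro α
    refine continuousOn_pi.2 fun A => ?_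
    rw [continuousOn_clm_apply]
    intro w
    refine (α A).continuous.comp_continuousOn ?_
    exact (((tangentBundleCore (𝓡 n) Q).continuousOn_coordChange j i).mono
      (fun x hx => ⟨hx.2, hx.1⟩)).clm_apply continuousOn_const
  coordChange_comp i j l x hx α := by
    funext A
    ext w
    exact congrArg (α A)
      ((tangentBundleCore (𝓡 n) Q).coordChange_comp l j i x ⟨⟨hx.2, hx.1.2⟩, hx.1.1⟩ w)

/-- The tangent bundle of `k¹`-velocities `T¹ₖQ`. -/
abbrev T1 : Type _ := TotalSpace (Fin k → Mdl n) (VelFiber n k Q)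

/-- The cotangent bundle of `k¹`-covelocities `(T¹ₖ)*Q`. -/
abbrev T1s : Type _ := TotalSpace (Fin k → (Mdl n →L[ℝ] ℝ)) (CovFiber n k Q)

/-- The Whitney sum `T¹ₖQ ⊕_Q (T¹ₖ)*Q`. -/
abbrev W : Type _ :=
  TotalSpace ((Fin k → Mdl n) × (Fin k → (Mdl n →L[ℝ] ℝ))) (VelFiber n k Q ×ᵇ CovFiber n k Q)

instance : TopologicalSpace (T1 n k Q) := inferInstanceAs <|
  TopologicalSpace (velCore n k Q).TotalSpace
instance : FiberBundle (Fin k → Mdl n) (VelFiber n k Q) := inferInstanceAs <|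
  FiberBundle (Fin k → Mdl n) (velCore n k Q).Fiber
instance : VectorBundle ℝ (Fin k → Mdl n) (VelFiber n k Q) := inferInstanceAs <|
  VectorBundle ℝ (Fin k → Mdl n) (velCore n k Q).Fiber

instance : TopologicalSpace (T1s n k Q) := inferInstanceAs <|
  TopologicalSpace (covCore n k Q).TotalSpace
instance : FiberBundle (Fin k → (Mdl n →L[ℝ] ℝ)) (CovFiber n k Q) := inferInstanceAs <|
  FiberBundle (Fin k → (Mdl n →L[ℝ] ℝ)) (covCore n k Q).Fiber
instance : VectorBundle ℝ (Fin k → (Mdl n →L[ℝ] ℝ)) (CovFiber n k Q) := inferInstanceAs <|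
  VectorBundle ℝ (Fin k → (Mdl n →L[ℝ] ℝ)) (covCore n k Q).Fiber

theorem tangentBundleCore_isContMDiff : (tangentBundleCore (𝓡 n) Q).IsContMDiff (𝓡 n) ∞ := by
  have : IsManifold (𝓡 n) (∞ + 1) Q := ‹IsManifold (𝓡 n) ∞ Q›
  exact tangentBundleCore.isContMDiff

instance : (velCore n k Q).IsContMDiff (𝓡 n) ∞ where
  contMDiffOn_coordChange i j := by
    have h := tangentBundleCore_isContMDiff n Q
    have hij := (tangentBundleCore (𝓡 n) Q).contMDiffOn_coordChange (𝓡 n) (n := ∞) i j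
    exact contMDiffOn_of_linear (F := Fin k → Mdl n) (fun T => ContinuousLinearMap.pi fun A =>
      T.comp (ContinuousLinearMap.proj A)) (fun _ _ => rfl) (fun _ _ => rfl) hij

instance : (covCore n k Q).IsContMDiff (𝓡 n) ∞ where
  contMDiffOn_coordChange i j := by
    have h := tangentBundleCore_isContMDiff n Q
    have hij := (tangentBundleCore (𝓡 n) Q).contMDiffOn_coordChange (𝓡 n) (n := ∞) j i
    refine contMDiffOn_of_linear (F := Fin k → (Mdl n →L[ℝ] ℝ)) (fun T => ContinuousLinearMap.pi fun A =>
      (ContinuousLinearMap.precomp ℝ T).comp (ContinuousLinearMap.proj A)) ?_ ?_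
      (hij.mono fun _ hx => And.symm hx)
    · intro S T
      ext α A w
      exact (α A).map_add _ _
    · intro c T
      ext α A w
      exact (α A).map_smul _ _

instance : ContMDiffVectorBundle ∞ (Fin k → Mdl n) (VelFiber n k Q) (𝓡 n) :=
  inferInstanceAs <| ContMDiffVectorBundle ∞ (Fin k → Mdl n) (velCore n k Q).Fiber (𝓡 n)
instance : ContMDiffVectorBundle ∞ (Fin k → (Mdl n →L[ℝ] ℝ)) (CovFiber n k Q) (𝓡 n) :=
  inferInstanceAs <|
    ContMDiffVectorBundle ∞ (Fin k → (Mdl n →L[ℝ] ℝ)) (covCore n k Q).Fiber (𝓡 n)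

/-- The model with corners of `T¹ₖQ`. -/
abbrev IV := (𝓡 n).prod 𝓘(ℝ, Fin k → Mdl n)

/-- The model with corners of `(T¹ₖ)*Q`. -/
abbrev IC := (𝓡 n).prod 𝓘(ℝ, Fin k → (Mdl n →L[ℝ] ℝ))

/-- The model with corners of `T¹ₖQ ⊕_Q (T¹ₖ)*Q`. -/
abbrev IW := (𝓡 n).prod 𝓘(ℝ, (Fin k → Mdl n) × (Fin k → (Mdl n →L[ℝ] ℝ)))

end Bundles

/-! ### Canonical structures -/

section Structures

variable {n k : ℕ} {Q : Type*} [TopologicalSpace Q] [ChartedSpace (Mdl n) Q]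

/-- The point `(v₁, …, v_k)` of `T¹ₖQ` over `q`. -/
def mkVel (q : Q) (v : Fin k → TangentSpace (𝓡 n) q) : T1 n k Q := ⟨q, v⟩

/-- The point `(α¹, …, αᵏ)` of `(T¹ₖ)*Q` over `q`. -/
def mkCov (q : Q) (α : Fin k → (TangentSpace (𝓡 n) q →L[ℝ] ℝ)) : T1s n k Q := ⟨q, α⟩

/-- The vector `v_A` of `v = (v₁, …, v_k)`. -/
def vel (v : T1 n k Q) : Fin k → TangentSpace (𝓡 n) v.proj := v.snd

/-- The covector `α^A` of `α = (α¹, …, αᵏ)`. -/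
def cov (α : T1s n k Q) : Fin k → (TangentSpace (𝓡 n) α.proj →L[ℝ] ℝ) := α.snd

/-- The projection of the Whitney sum onto `T¹ₖQ`. -/
def pr1 (z : W n k Q) : T1 n k Q := ⟨z.proj, z.snd.1⟩

/-- The projection of the Whitney sum onto `(T¹ₖ)*Q`. -/
def pr2 (z : W n k Q) : T1s n k Q := ⟨z.proj, z.snd.2⟩

/-- The inclusion of the fibre of `T¹ₖQ` over `q`; the fibre is written as `(ℝⁿ)ᵏ` through the
identification of `T_qQ` with `ℝⁿ` given by the chart around `q`. -/
def fibreIncl (q : Q) (u : Fin k → Mdl n) : T1 n k Q := mkVel q u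

/-- The fibre derivative at `v` of a function on `T¹ₖQ`. -/
def fibreDeriv (L : T1 n k Q → ℝ) (v : T1 n k Q) : (Fin k → Mdl n) →L[ℝ] ℝ :=
  fderiv ℝ (fun u => L (fibreIncl v.proj u)) (vel v)

/-- `L` is regular: at every `v`, the matrix `∂²L/∂v^i_A ∂v^j_B` has non-zero determinant. The
coordinates `v^i_A` are those induced by the chart of `Q` around the base point of `v`; the
condition does not depend on this choice. -/
def IsRegularLagrangian (L : T1 n k Q → ℝ) : Prop :=
  ∀ v : T1 n k Q,
    (Matrix.of fun (a b : Fin n × Fin k) =>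
      fderiv ℝ (fun u => fibreDeriv L (fibreIncl v.proj u)
          (Pi.single b.2 (EuclideanSpace.single b.1 (1 : ℝ)))) (vel v)
        (Pi.single a.2 (EuclideanSpace.single a.1 (1 : ℝ)))).det ≠ 0

/-- The Legendre map: `[FL(v)]^A(w) = d/ds L(v₁, …, v_A + s w, …, v_k)` at `s = 0`. -/
def legendre (L : T1 n k Q → ℝ) (v : T1 n k Q) : T1s n k Q :=
  mkCov v.proj fun A =>
    (fibreDeriv L v).comp (ContinuousLinearMap.single ℝ (fun _ : Fin k => Mdl n) A)

/-- `E_L = C(L) - L`, where `C` is the generator of the flow `(s, v) ↦ eˢ v` on `T¹ₖQ`. -/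
def energy (L : T1 n k Q → ℝ) (v : T1 n k Q) : ℝ :=
  deriv (fun s : ℝ => L (mkVel v.proj (Real.exp s • vel v))) 0 - L v

/-- The coupling function `∑_A α^A(v_A)` on the Whitney sum. -/
def coupling (z : W n k Q) : ℝ := ∑ A, cov (pr2 z) A (vel (pr1 z) A)

/-- The Hamiltonian function `coupling - L ∘ pr1` on the Whitney sum. -/
def unifiedHamiltonian (L : T1 n k Q → ℝ) (z : W n k Q) : ℝ := coupling z - L (pr1 z)

/-- The map `v ↦ (v, FL(v))` into the Whitney sum. -/
def graphMap (L : T1 n k Q → ℝ) (v : T1 n k Q) : W n k Q :=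
  ⟨v.proj, (v.snd, (legendre L v).snd)⟩

/-- `M_L`, the graph of the Legendre map. -/
def graphSet (L : T1 n k Q → ℝ) : Set (W n k Q) := {z | pr2 z = legendre L (pr1 z)}

variable [IsManifold (𝓡 n) ∞ Q]

/-- `(θ₀)_A`, the pull-back of the Liouville form of `T*Q` to `(T¹ₖ)*Q` under the `A`-th
projection: `(θ₀)_A(α)(X) = α^A(τ_* X)`, with `τ : (T¹ₖ)*Q → Q` the bundle projection. -/
def theta0 (A : Fin k) (α : T1s n k Q) : TangentSpace (IC n k) α →L[ℝ] ℝ :=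
  (cov α A).comp (mfderiv (IC n k) (𝓡 n) (fun β : T1s n k Q => β.proj) α)

/-- `(ω₀)_A = -d(θ₀)_A`: the canonical `k`-symplectic structure of `(T¹ₖ)*Q`. -/
def omega0 (A : Fin k) (α : T1s n k Q) : TangentSpace (IC n k) α [⋀^Fin 2]→L[ℝ] ℝ :=
  -extDerivOneForm (IC n k) (theta0 A) α

/-- `Ω_A`, the pull-back of `(ω₀)_A` to the Whitney sum under `pr2`. -/
def OmegaW (A : Fin k) (z : W n k Q) : TangentSpace (IW n k) z [⋀^Fin 2]→L[ℝ] ℝ :=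
  (omega0 A (pr2 z)).compContinuousLinearMap (mfderiv (IW n k) (IC n k) pr2 z)

/-- The vertical `A`-lift `X ↦ d/ds (v₁, …, v_A + s X, …, v_k)` at `s = 0`. -/
def verticalLift (A : Fin k) (v : T1 n k Q) :
    TangentSpace (𝓡 n) v.proj →L[ℝ] TangentSpace (IV n k) v :=
  let D : (Fin k → Mdl n) →L[ℝ] TangentSpace (IV n k) v :=
    mfderiv 𝓘(ℝ, Fin k → Mdl n) (IV n k) (fibreIncl v.proj) (vel v)
  D.comp (ContinuousLinearMap.single ℝ (fun _ : Fin k => Mdl n) A)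

/-- The canonical `k`-tangent structure: `S^A(v)(Z)` is the vertical `A`-lift of `τ_* Z`. -/
def tangentStructure (A : Fin k) (v : T1 n k Q) :
    TangentSpace (IV n k) v →L[ℝ] TangentSpace (IV n k) v :=
  (verticalLift A v).comp (mfderiv (IV n k) (𝓡 n) (fun u : T1 n k Q => u.proj) v)

/-- `(θ_L)_A = dL ∘ S^A`. -/
def thetaL (L : T1 n k Q → ℝ) (A : Fin k) (v : T1 n k Q) : TangentSpace (IV n k) v →L[ℝ] ℝ :=
  (mfderiv (IV n k) 𝓘(ℝ, ℝ) L v).comp (tangentStructure A v)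

/-- `(ω_L)_A = -d(θ_L)_A`. -/
def omegaL (L : T1 n k Q → ℝ) (A : Fin k) (v : T1 n k Q) :
    TangentSpace (IV n k) v [⋀^Fin 2]→L[ℝ] ℝ :=
  -extDerivOneForm (IV n k) (thetaL L A) v

/-- `X_L` is a smooth `k`-vector field on `U ⊆ T¹ₖQ` solving `∑_A i_{X_A} (ω_L)_A = dE_L`. -/
def IsLagrangianSolution (L : T1 n k Q → ℝ) (X : KVectorField (IV n k) (T1 n k Q) k)
    (U : Set (T1 n k Q)) : Prop :=
  IsSmoothOn (IV n k) X U ∧ SolvesOn (IV n k) (omegaL L) (energy L) X U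

/-- `X_H` is a smooth `k`-vector field on `V ⊆ (T¹ₖ)*Q` solving `∑_A i_{X_A} (ω₀)_A = dH`. -/
def IsHamiltonianSolution (H : T1s n k Q → ℝ) (X : KVectorField (IC n k) (T1s n k Q) k)
    (V : Set (T1s n k Q)) : Prop :=
  IsSmoothOn (IC n k) X V ∧ SolvesOn (IC n k) omega0 H X V

/-- `Z` is a smooth `k`-vector field on the part of `M_L` over `U ⊆ T¹ₖQ`, tangent to `M_L`, and
solves `∑_A i_{Z_A} Ω_A = d(coupling - L ∘ pr1)` there, as an equality of covectors of the whole
Whitney sum. -/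
def IsUnifiedSolution (L : T1 n k Q → ℝ) (Z : KVectorField (IW n k) (W n k Q) k)
    (U : Set (T1 n k Q)) : Prop :=
  IsSmoothOn (IW n k) Z (graphSet L ∩ pr1 ⁻¹' U) ∧
  (∀ v ∈ U, ∀ A, ∃ Y : TangentSpace (IV n k) v,
    mfderiv (IV n k) (IW n k) (graphMap L) v Y = Z A (graphMap L v)) ∧
  SolvesOn (IW n k) OmegaW (unifiedHamiltonian L) Z (graphSet L ∩ pr1 ⁻¹' U)

/-- `T¹ₖ(FL) ∘ X_L = X_H ∘ FL` on `U`. -/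
def IsLegendreRelated (L : T1 n k Q → ℝ) (XL : KVectorField (IV n k) (T1 n k Q) k)
    (XH : KVectorField (IC n k) (T1s n k Q) k) (U : Set (T1 n k Q)) : Prop :=
  ∀ v ∈ U, ∀ A, mfderiv (IV n k) (IC n k) (legendre L) v (XL A v) = XH A (legendre L v)

/-- `X_L ∘ pr1 = T¹ₖ(pr1) ∘ Z` on the part of `M_L` over `U`. -/
def IsProjectionOf (L : T1 n k Q → ℝ) (XL : KVectorField (IV n k) (T1 n k Q) k)
    (Z : KVectorField (IW n k) (W n k Q) k) (U : Set (T1 n k Q)) : Prop :=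
  ∀ z ∈ graphSet L ∩ pr1 ⁻¹' U, ∀ A,
    XL A (pr1 z) = mfderiv (IW n k) (IV n k) pr1 z (Z A z)

end Structures

end KSymplectic

end

open KSymplectic

/-!
The Legendre map `FL` covers the identity of `Q` and `θ_L^A = FL^* θ₀^A`, because the vertical lift
followed by `dL` is the fibre derivative of `L` (`thetaL_eq_pullback`). The exterior derivative
commutes with pull-backs (`extDerivOneForm_pullback`), so `ω_L^A = FL^* ω₀^A`
(`omegaL_eq_pullback`). Wherever `FL` is a diffeomorphism and `H ∘ FL = E_L`, two `k`-vector fields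
related by `FL` therefore solve the Lagrangian and the Hamiltonian equation simultaneously
(`isSolution_iff_of_legendreRelated`); this gives the first correspondence.

Local solvability is a computation in coordinates. In the chart of `T¹ₖQ` around a point the
Legendre map reads `(q, v) ↦ (q, ∂ℓ/∂v)`, whose derivative is invertible exactly when the fibre
Hessian is, so the inverse function theorem applies (`exists_partialDiffeomorph_legendre`). In the
chart of `(T¹ₖ)*Q` one has `ω₀^A = dq^i ∧ dp^A_i` (`omega0_eq_pullback`), and
`∑_A i_{X_A} (dq^i ∧ dp^A_i) = dh` is solved by `X_A = ∂h/∂p^A_i ∂/∂q^i - (1/k) ∂h/∂q^i ∂/∂p^A_i`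
(`sum_omegaModel_hamiltonField`).

For the unified formalism, let `X_L` be the pull-back of `X_H` by `FL` and let `Z` be the
push-forward of `X_L` along the graph map `v ↦ (v, FL v)`. On vectors tangent to the graph, the
unified equation for `Z` is the Lagrangian equation for `X_L`, since `Ω_A` restricts to `ω_L^A` and
the unified Hamiltonian to `E_L`. As `FL_*` is onto, every tangent vector of the Whitney sum at a
point of the graph is the sum of a vector tangent to the graph and a vector in `ker pr2_*`. On
`ker pr2_*` the contraction of `Ω_A = pr2^* ω₀^A` vanishes, and so does the differential of the
unified Hamiltonian: its `dv^i_A`-component is `p^A_i - ∂L/∂v^i_A`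
(`mfderiv_unifiedHamiltonian_eq_zero`, `solvesOn_graph`). Integral sections of `X_H` are mapped to
integral sections of `Z` by `v ↦ (v, FL v)` composed with the inverse of `FL`.
-/

open Filter Topology

namespace KSymplectic

/-! ### Exterior derivative and `k`-vector fields under smooth maps -/

section Calculus

variable {E : Type*} [NormedAddCommGroup E] [NormedSpace ℝ E]
  {H : Type*} [TopologicalSpace H] {I : ModelWithCorners ℝ E H}
  {M : Type*} [TopologicalSpace M] [ChartedSpace H M]
  {E' : Type*} [NormedAddCommGroup E'] [NormedSpace ℝ E']
  {H' : Type*} [TopologicalSpace H'] {J : ModelWithCorners ℝ E' H'}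
  {N : Type*} [TopologicalSpace N] [ChartedSpace H' N]

/-- Equal base points give equal covectors of the model space, although the tangent spaces at `a`
and `b` are different types. -/
theorem oneForm_congr (θ : ∀ x : M, TangentSpace I x →L[ℝ] ℝ) {a b : M} (h : a = b) (w : E) :
    (θ a : E →L[ℝ] ℝ) w = (θ b : E →L[ℝ] ℝ) w := by
  subst h; rfl

variable (I) in
/-- The expression of the 1-form `θ` in the chart around `x`. -/
noncomputable def chartForm (x : M) (θ : ∀ x : M, TangentSpace I x →L[ℝ] ℝ) (y : E) : E →L[ℝ] ℝ :=
  (θ ((extChartAt I x).symm y)).comp (mfderiv 𝓘(ℝ, E) I (extChartAt I x).symm y)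

/-- The exterior derivative of 1-forms commutes with pull-back. In charts this is
`extDeriv_pullback` for the local expression `φ` of `f`, once the local expression of `η` has been
identified with the pull-back by `φ` of that of `θ`. -/
theorem extDerivOneForm_pullback [I.Boundaryless] [J.Boundaryless] [IsManifold I ∞ M]
    [IsManifold J ∞ N] {f : M → N} {x : M} (hf : ContMDiffAt I J ∞ f x)
    {θ : ∀ x : N, TangentSpace J x →L[ℝ] ℝ} {η : ∀ x : M, TangentSpace I x →L[ℝ] ℝ}
    (hη : ∀ᶠ y in 𝓝 x, η y = (θ (f y)).comp (mfderiv I J f y))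
    (hθ : DifferentiableAt ℝ (chartForm J (f x) θ) (extChartAt J (f x) (f x))) :
    extDerivOneForm I η x =
      (extDerivOneForm J θ (f x)).compContinuousLinearMap (mfderiv I J f x) := by
  set χ := extChartAt I x with hχ
  set ξ := extChartAt J (f x) with hξ
  set φ : E → E' := writtenInExtChartAt I J x f with hφ
  have hφd : ContDiffAt ℝ ∞ φ (χ x) := by
    have := (contMDiffAt_iff.1 hf).2
    rwa [I.range_eq_univ, contDiffWithinAt_univ] at this
  have hφx : φ (χ x) = ξ (f x) := by simp [hφ, hχ, hξ, writtenInExtChartAt]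
  have hfd : MDifferentiableAt I J f x := hf.mdifferentiableAt (by simp)
  have hev : ∀ᶠ y in 𝓝 x, ContMDiffAt I J 1 f y :=
    (contMDiffAt_iff_contMDiffAt_nhds (by simp)).1 (hf.of_le (by simp))
  have hsrc : ∀ᶠ y in 𝓝 x, f y ∈ ξ.source :=
    hf.continuousAt.preimage_mem_nhds (extChartAt_source_mem_nhds (I := J) (f x))
  have hcont : Tendsto χ.symm (𝓝 (χ x)) (𝓝 x) := by
    have h := (continuousAt_extChartAt_symm (I := I) x)
    have h2 : (extChartAt I x).symm (extChartAt I x x) = x := extChartAt_to_inv x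
    rw [ContinuousAt, h2] at h
    exact h
  have key : (fun y => chartForm I x η y) =ᶠ[𝓝 (χ x)]
      fun y => (chartForm J (f x) θ (φ y)).comp (fderiv ℝ φ y) := by
    have hφev : ∀ᶠ y in 𝓝 (χ x), ContDiffAt ℝ 1 φ y :=
      (hφd.of_le (by simp)).eventually (by simp)
    have hnear : ∀ᶠ y in 𝓝 (χ x), ∀ᶠ z in 𝓝 y, f (χ.symm z) ∈ ξ.source :=
      eventually_eventually_nhds.2 (hcont.eventually hsrc)
    filter_upwards [hφev, hcont.eventually hev, hnear, hcont.eventually hη,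
      extChartAt_target_mem_nhds (I := I) x] with y hy1 hy2 hy3 hy4 hy5
    have hsy : MDifferentiableAt 𝓘(ℝ, E) I χ.symm y :=
      ((contMDiffOn_extChartAt_symm (I := I) (n := 1) x).contMDiffAt
        ((isOpen_extChartAt_target x).mem_nhds hy5)).mdifferentiableAt one_ne_zero
    have hyt : φ y ∈ ξ.target := ξ.map_source hy3.self_of_nhds
    have hξy : MDifferentiableAt 𝓘(ℝ, E') J ξ.symm (φ y) :=
      ((contMDiffOn_extChartAt_symm (I := J) (n := 1) (f x)).contMDiffAt
        ((isOpen_extChartAt_target _).mem_nhds hyt)).mdifferentiableAt one_ne_zero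
    have hφy : MDifferentiableAt 𝓘(ℝ, E) 𝓘(ℝ, E') φ y :=
      (hy1.differentiableAt one_ne_zero).mdifferentiableAt
    have hloc : (f ∘ χ.symm) =ᶠ[𝓝 y] (ξ.symm ∘ φ) := by
      filter_upwards [hy3] with z hz
      exact (ξ.left_inv hz).symm
    have hd : (mfderiv I J f (χ.symm y)).comp (mfderiv 𝓘(ℝ, E) I χ.symm y) =
        (mfderiv 𝓘(ℝ, E') J ξ.symm (φ y)).comp (mfderiv 𝓘(ℝ, E) 𝓘(ℝ, E') φ y) := by
      rw [← mfderiv_comp y (hy2.mdifferentiableAt one_ne_zero) hsy, ← mfderiv_comp y hξy hφy]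
      exact hloc.mfderiv_eq
    ext w
    have e1 : chartForm I x η y w = (θ (f (χ.symm y)) : E' →L[ℝ] ℝ)
        ((mfderiv I J f (χ.symm y)).comp (mfderiv 𝓘(ℝ, E) I χ.symm y) w) := by
      change (η (χ.symm y)) (mfderiv 𝓘(ℝ, E) I χ.symm y w) = _
      rw [hy4]; rfl
    have e2 : (chartForm J (f x) θ (φ y)).comp (fderiv ℝ φ y) w =
        (θ (ξ.symm (φ y)) : E' →L[ℝ] ℝ)
        ((mfderiv 𝓘(ℝ, E') J ξ.symm (φ y)).comp (mfderiv 𝓘(ℝ, E) 𝓘(ℝ, E') φ y) w) := by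
      rw [mfderiv_eq_fderiv]; rfl
    rw [e1, e2, hd]
    exact oneForm_congr θ hloc.self_of_nhds _
  have key2 : extDeriv (fun y : E => ContinuousAlternatingMap.ofSubsingleton ℝ E ℝ (0 : Fin 1)
      (chartForm I x η y)) (χ x) =
      (extDeriv (fun y : E' => ContinuousAlternatingMap.ofSubsingleton ℝ E' ℝ (0 : Fin 1)
      (chartForm J (f x) θ y)) (φ (χ x))).compContinuousLinearMap (fderiv ℝ φ (χ x)) := by
    rw [← extDeriv_pullback (r := ∞) _ hφd (by
      simp only [minSmoothness_of_isRCLikeNormedField]; exact ENat.LEInfty.out)]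
    · apply Filter.EventuallyEq.extDeriv_eq
      filter_upwards [key] with y hy
      rw [hy]; ext w; simp
    · rw [hφx]
      exact (ContinuousAlternatingMap.ofSubsingletonLIE (𝕜 := ℝ) (E := E') (F := ℝ)
        (0 : Fin 1)).toContinuousLinearEquiv.differentiableAt.comp _ hθ
  have hd : (mfderiv 𝓘(ℝ, E) 𝓘(ℝ, E') φ (χ x)).comp (mfderiv I 𝓘(ℝ, E) χ x) =
      (mfderiv J 𝓘(ℝ, E') ξ (f x)).comp (mfderiv I J f x) := by
    have h1 : MDifferentiableAt I 𝓘(ℝ, E) χ x :=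
      (contMDiffAt_extChartAt (n := 1)).mdifferentiableAt one_ne_zero
    have h2 : MDifferentiableAt J 𝓘(ℝ, E') ξ (f x) :=
      (contMDiffAt_extChartAt (n := 1)).mdifferentiableAt one_ne_zero
    have h3 : MDifferentiableAt 𝓘(ℝ, E) 𝓘(ℝ, E') φ (χ x) :=
      (hφd.differentiableAt (by simp)).mdifferentiableAt
    rw [← mfderiv_comp x h3 h1, ← mfderiv_comp x h2 hfd]
    apply Filter.EventuallyEq.mfderiv_eq
    filter_upwards [extChartAt_source_mem_nhds (I := I) x] with z hz
    exact congrArg (fun y => ξ (f y)) (χ.left_inv hz)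
  ext v
  have e1 : extDerivOneForm I η x v = extDeriv (fun y : E =>
      ContinuousAlternatingMap.ofSubsingleton ℝ E ℝ (0 : Fin 1)
      (chartForm I x η y)) (χ x) (fun i => mfderiv I 𝓘(ℝ, E) χ x (v i)) := rfl
  rw [e1, key2, hφx, ← mfderiv_eq_fderiv]
  have e2 : ∀ i, mfderiv 𝓘(ℝ, E) 𝓘(ℝ, E') φ (χ x) (mfderiv I 𝓘(ℝ, E) χ x (v i)) =
      mfderiv J 𝓘(ℝ, E') ξ (f x) (mfderiv I J f x (v i)) := fun i =>
    DFunLike.congr_fun hd (v i)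
  have e3 := funext e2
  exact congrArg _ e3

theorem chartForm_modelSpace (θ : E → E →L[ℝ] ℝ) (x : E) :
    chartForm 𝓘(ℝ, E) x θ = θ := by
  funext y
  ext w
  have h : ((extChartAt 𝓘(ℝ, E) x).symm : E → E) = id := by
    rw [extChartAt_model_space_eq_id]; rfl
  have hm : (mfderiv 𝓘(ℝ, E) 𝓘(ℝ, E) (extChartAt 𝓘(ℝ, E) x).symm y : E →L[ℝ] E) w = w := by
    rw [h, mfderiv_id]; rfl
  have e : chartForm 𝓘(ℝ, E) x θ y w = θ ((extChartAt 𝓘(ℝ, E) x).symm y)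
    ((mfderiv 𝓘(ℝ, E) 𝓘(ℝ, E) (extChartAt 𝓘(ℝ, E) x).symm y : E →L[ℝ] E) w) := rfl
  rw [e, hm, h, id]

theorem extDerivOneForm_modelSpace {θ : E → E →L[ℝ] ℝ} {x : E}
    (hθ : DifferentiableAt ℝ θ x) (u w : E) :
    extDerivOneForm 𝓘(ℝ, E) θ x ![u, w] = fderiv ℝ θ x u w - fderiv ℝ θ x w u := by
  have hd : DifferentiableAt ℝ (fun y : E =>
      ContinuousAlternatingMap.ofSubsingleton ℝ E ℝ (0 : Fin 1) (θ y)) x :=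
    (ContinuousAlternatingMap.ofSubsingletonLIE (𝕜 := ℝ) (E := E) (F := ℝ)
        (0 : Fin 1)).toContinuousLinearEquiv.differentiableAt.comp _ hθ
  have e1 : extDerivOneForm 𝓘(ℝ, E) θ x ![u, w] = extDeriv (fun y : E =>
      ContinuousAlternatingMap.ofSubsingleton ℝ E ℝ (0 : Fin 1)
      (chartForm 𝓘(ℝ, E) x θ y)) x ![u, w] := by
    have : extDerivOneForm 𝓘(ℝ, E) θ x ![u, w] = extDeriv (fun y : E =>
      ContinuousAlternatingMap.ofSubsingleton ℝ E ℝ (0 : Fin 1)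
      (chartForm 𝓘(ℝ, E) x θ y)) (extChartAt 𝓘(ℝ, E) x x)
        (fun i => mfderiv 𝓘(ℝ, E) 𝓘(ℝ, E) (extChartAt 𝓘(ℝ, E) x) x (![u, w] i)) := rfl
    rw [this, extChartAt_model_space_eq_id]
    simp only [PartialEquiv.refl_coe]
    rw [mfderiv_id]
    rfl
  have hc (v : E) : (fun y : E => θ y v) =
    (ContinuousLinearMap.apply ℝ ℝ v) ∘ θ := rfl
  have hc' (v u : E) : fderiv ℝ (fun y : E => θ y v) x u =
      fderiv ℝ θ x u v := by
    rw [hc, fderiv_comp x (ContinuousLinearMap.differentiableAt _) hθ]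
    simp
  rw [e1, chartForm_modelSpace, extDeriv_apply hd, Fin.sum_univ_two]
  simp [Fin.removeNth, Fin.succAbove, hc', sub_eq_add_neg]

variable {k : ℕ} {X : KVectorField I M k} {Y : KVectorField J N k}
  {f : M → N} {g : N → M} {s : Set M} {t : Set N}

/-- A `k`-vector field on `t` which is `f`-related to a smooth one is smooth when `f` has a smooth
section `g` on `t`. The set `t` need not be open, so that `f` may be an embedding. -/
theorem IsSmoothOn.map [IsManifold I ∞ M] [IsManifold J ∞ N] (hX : IsSmoothOn I X s)
    (hs : IsOpen s) (hf : ContMDiffOn I J ∞ f s)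
    (hg : ContMDiffOn J I ∞ g t) (hgs : MapsTo g t s) (hfg : ∀ y ∈ t, f (g y) = y)
    (hXY : ∀ x ∈ s, ∀ A, mfderiv I J f x (X A x) = Y A (f x)) : IsSmoothOn J Y t := by
  intro A
  have hT : ContMDiffOn I.tangent J.tangent ∞ (tangentMapWithin I J f s)
      (π E (TangentSpace I) ⁻¹' s) :=
    ContMDiffOn.contMDiffOn_tangentMapWithin hf (by simp) hs.uniqueMDiffOn
  have h1 : ContMDiffOn J I.tangent ∞ (fun y => (⟨g y, X A (g y)⟩ : TangentBundle I M)) t :=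
    (hX A).comp hg hgs
  have h2 := hT.comp h1 (fun y hy => hgs hy)
  refine h2.congr fun y hy => ?_
  have e : (⟨y, Y A y⟩ : TangentBundle J N) = ⟨f (g y), Y A (f (g y))⟩ := by rw [hfg y hy]
  rw [e, ← hXY _ (hgs hy) A]
  simp only [Function.comp, tangentMapWithin]
  rw [mfderivWithin_eq_mfderiv (hs.uniqueMDiffOn _ (hgs hy))
    ((hf.contMDiffAt (hs.mem_nhds (hgs hy))).mdifferentiableAt (by simp))]

/-- A smooth map relating two `k`-vector fields maps integral sections to integral sections. -/
theorem IsIntegrableOn.map (hX : IsIntegrableOn I X s) (hs : IsOpen s)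
    (hf : ContMDiffOn I J ∞ f s) (hst : MapsTo f s t) (hsurj : SurjOn f s t)
    (hXY : ∀ x ∈ s, ∀ A, mfderiv I J f x (X A x) = Y A (f x)) : IsIntegrableOn J Y t := by
  intro y hy
  obtain ⟨x, hx, rfl⟩ := hsurj hy
  obtain ⟨U₀, ψ, h⟩ := hX x hx
  refine ⟨U₀, f ∘ ψ, h.isOpen, h.zero_mem, congrArg f h.map_zero, hf.comp h.smooth h.mapsTo,
    hst.comp h.mapsTo, fun τ hτ A => ?_⟩
  have hfd := (hf.contMDiffAt (hs.mem_nhds (h.mapsTo hτ))).mdifferentiableAt (n := ∞) (by simp)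
  have hψd := (h.smooth.contMDiffAt (h.isOpen.mem_nhds hτ)).mdifferentiableAt (n := ∞) (by simp)
  rw [mfderiv_comp τ hfd hψd]
  have := h.deriv_eq τ hτ A
  exact (congrArg (mfderiv I J f (ψ τ)) this).trans (hXY _ (h.mapsTo hτ) A)

theorem compContinuousLinearMap_pair {V V' : Type*} [AddCommGroup V] [Module ℝ V]
    [TopologicalSpace V] [AddCommGroup V'] [Module ℝ V'] [TopologicalSpace V']
    (σ : V' [⋀^Fin 2]→L[ℝ] ℝ) (D : V →L[ℝ] V') (a b : V) :
    σ.compContinuousLinearMap D ![a, b] = σ ![D a, D b] := by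
  refine congrArg σ ?_
  funext i
  fin_cases i <;> rfl

theorem sum_contraction_pullback {w : Fin k → ∀ x : M, TangentSpace I x [⋀^Fin 2]→L[ℝ] ℝ}
    {σ : Fin k → ∀ x : N, TangentSpace J x [⋀^Fin 2]→L[ℝ] ℝ} {x : M}
    (hw : ∀ A, w A x = (σ A (f x)).compContinuousLinearMap (mfderiv I J f x))
    (hXY : ∀ A, mfderiv I J f x (X A x) = Y A (f x)) (v : TangentSpace I x) :
    ∑ A, w A x ![X A x, v] = ∑ A, σ A (f x) ![Y A (f x), mfderiv I J f x v] :=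
  Finset.sum_congr rfl fun A _ => by rw [hw, ← hXY, compContinuousLinearMap_pair]

/-- If `f` is a submersion pulling `σ` back to `w` and `h` back to `e`, then `f`-related `k`-vector
fields solve the field equations for `(w, e)` and `(σ, h)` simultaneously. -/
theorem solvesOn_iff_of_related {w : Fin k → ∀ x : M, TangentSpace I x [⋀^Fin 2]→L[ℝ] ℝ}
    {σ : Fin k → ∀ x : N, TangentSpace J x [⋀^Fin 2]→L[ℝ] ℝ} {e : M → ℝ} {h : N → ℝ}
    (hs : IsOpen s) (hst : f '' s = t)
    (hf : ∀ x ∈ s, MDifferentiableAt I J f x) (hh : ∀ y ∈ t, MDifferentiableAt J 𝓘(ℝ, ℝ) h y)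
    (hfs : ∀ x ∈ s, Function.Surjective (mfderiv I J f x))
    (hw : ∀ x ∈ s, ∀ A, w A x = (σ A (f x)).compContinuousLinearMap (mfderiv I J f x))
    (heh : ∀ x ∈ s, h (f x) = e x)
    (hXY : ∀ x ∈ s, ∀ A, mfderiv I J f x (X A x) = Y A (f x)) :
    SolvesOn I w e X s ↔ SolvesOn J σ h Y t := by
  have hd : ∀ x ∈ s, ∀ v, mfderiv I 𝓘(ℝ, ℝ) e x v =
      mfderiv J 𝓘(ℝ, ℝ) h (f x) (mfderiv I J f x v) := by
    intro x hx v
    have h1 : e =ᶠ[𝓝 x] h ∘ f := by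
      filter_upwards [hs.mem_nhds hx] with y hy using (heh y hy).symm
    have h2 := mfderiv_comp x (hh (f x) (hst ▸ mem_image_of_mem f hx)) (hf x hx)
    have h3 := h1.mfderiv_eq (I := I) (I' := 𝓘(ℝ, ℝ))
    have h4 := DFunLike.congr_fun (h3.trans h2) v
    exact h4
  subst hst
  constructor
  · rintro H _ ⟨x, hx, rfl⟩ v
    obtain ⟨v, rfl⟩ := hfs x hx v
    rw [← hd x hx, ← H x hx, sum_contraction_pullback (hw x hx) (hXY x hx)]
  · intro H x hx v
    rw [hd x hx, ← H _ (mem_image_of_mem f hx), sum_contraction_pullback (hw x hx) (hXY x hx)]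

end Calculus

/-! ### Charts of the bundles and the canonical forms in coordinates -/

section Coordinates

variable {n k : ℕ} {Q : Type*} [TopologicalSpace Q] [ChartedSpace (Mdl n) Q]
  [IsManifold (𝓡 n) ∞ Q]

/-- The model space of `(T¹ₖ)*Q`, with coordinates `(q^i, p^A_i)`. -/
abbrev PhaseModel (n k : ℕ) : Type := Mdl n × (Fin k → (Mdl n →L[ℝ] ℝ))

theorem extChartAt_vel_apply (v₀ v : T1 n k Q) :
    extChartAt (IV n k) v₀ v = (extChartAt (𝓡 n) v₀.proj v.proj,
      fun A => tangentCoordChange (𝓡 n) v.proj v₀.proj v.proj (vel v A)) := by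
  rw [FiberBundle.extChartAt]; rfl

theorem extChartAt_cov_apply (α₀ α : T1s n k Q) :
    extChartAt (IC n k) α₀ α = (extChartAt (𝓡 n) α₀.proj α.proj,
      fun A => (cov α A).comp (tangentCoordChange (𝓡 n) α₀.proj α.proj α.proj)) := by
  rw [FiberBundle.extChartAt]; rfl

theorem extChartAt_whitney_apply (z₀ z : W n k Q) :
    extChartAt (IW n k) z₀ z = (extChartAt (𝓡 n) z₀.proj z.proj,
      fun A => tangentCoordChange (𝓡 n) z.proj z₀.proj z.proj (vel (pr1 z) A),
      fun A => (cov (pr2 z) A).comp (tangentCoordChange (𝓡 n) z₀.proj z.proj z.proj)) := by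
  rw [FiberBundle.extChartAt]; rfl

theorem mem_extChartAt_vel_source {v₀ v : T1 n k Q} :
    v ∈ (extChartAt (IV n k) v₀).source ↔ v.proj ∈ (extChartAt (𝓡 n) v₀.proj).source := by
  simp only [FiberBundle.chartedSpace_chartAt, mfld_simps]
  exact and_self_iff

theorem mem_extChartAt_cov_source {α₀ α : T1s n k Q} :
    α ∈ (extChartAt (IC n k) α₀).source ↔ α.proj ∈ (extChartAt (𝓡 n) α₀.proj).source := by
  simp only [FiberBundle.chartedSpace_chartAt, mfld_simps]
  exact and_self_iff

theorem mem_extChartAt_whitney_source {z₀ z : W n k Q} :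
    z ∈ (extChartAt (IW n k) z₀).source ↔ z.proj ∈ (extChartAt (𝓡 n) z₀.proj).source := by
  simp only [FiberBundle.chartedSpace_chartAt, mfld_simps]
  exact and_iff_right_iff_imp.2 fun h => ⟨h, h⟩

theorem tangentCoordChange_inverse {q x : Q} (hx : x ∈ (extChartAt (𝓡 n) q).source) (w : Mdl n) :
    tangentCoordChange (𝓡 n) x q x (tangentCoordChange (𝓡 n) q x x w) = w := by
  rw [tangentCoordChange_comp ⟨⟨hx, mem_extChartAt_source x⟩, hx⟩, tangentCoordChange_self hx]

theorem tangentCoordChange_inverse' {q x : Q} (hx : x ∈ (extChartAt (𝓡 n) q).source) (w : Mdl n) :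
    tangentCoordChange (𝓡 n) q x x (tangentCoordChange (𝓡 n) x q x w) = w := by
  rw [tangentCoordChange_comp ⟨⟨mem_extChartAt_source x, hx⟩, mem_extChartAt_source x⟩,
    tangentCoordChange_self (mem_extChartAt_source x)]

theorem mfderiv_extChartAt_eq_tangentCoordChange {q x : Q} (hx : x ∈ (extChartAt (𝓡 n) q).source) :
    mfderiv (𝓡 n) 𝓘(ℝ, Mdl n) (extChartAt (𝓡 n) q) x = tangentCoordChange (𝓡 n) x q x := by
  rw [extChartAt_source] at hx
  rw [(hasMFDerivAt_extChartAt hx).mfderiv, mfderiv_chartAt_eq_tangentCoordChange hx]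

theorem contMDiff_pr1 : ContMDiff (IW n k) (IV n k) ∞ (pr1 : W n k Q → T1 n k Q) := by
  intro z₀
  have h : ContMDiffAt (IW n k) (IW n k) ∞ (fun z : W n k Q => z) z₀ := contMDiffAt_id
  rw [contMDiffAt_totalSpace] at h ⊢
  exact ⟨h.1, contDiffAt_fst.contMDiffAt.comp z₀ h.2⟩

theorem contMDiff_pr2 : ContMDiff (IW n k) (IC n k) ∞ (pr2 : W n k Q → T1s n k Q) := by
  intro z₀
  have h : ContMDiffAt (IW n k) (IW n k) ∞ (fun z : W n k Q => z) z₀ := contMDiffAt_id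
  rw [contMDiffAt_totalSpace] at h ⊢
  have h2 : ContMDiff 𝓘(ℝ, (Fin k → Mdl n) × (Fin k → (Mdl n →L[ℝ] ℝ)))
      𝓘(ℝ, Fin k → (Mdl n →L[ℝ] ℝ)) ∞ Prod.snd := contDiff_snd.contMDiff
  exact ⟨h.1, h2.contMDiffAt.comp z₀ h.2⟩

theorem contMDiff_fibreIncl (q : Q) :
    ContMDiff 𝓘(ℝ, Fin k → Mdl n) (IV n k) ∞ (fibreIncl q : (Fin k → Mdl n) → T1 n k Q) := by
  intro u₀
  rw [contMDiffAt_totalSpace]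
  refine ⟨contMDiffAt_const, ?_⟩
  refine contMDiffAt_id.congr_of_eventuallyEq (Eventually.of_forall fun u => ?_)
  funext A
  exact tangentCoordChange_self (mem_extChartAt_source q)

/-- The inclusion `u ↦ (u, α)` of a slice of the fibre of the Whitney sum over `q`. -/
def sliceIncl (q : Q) (α : Fin k → (Mdl n →L[ℝ] ℝ)) (u : Fin k → Mdl n) :
    W n k Q := ⟨q, (u, α)⟩

theorem extChartAt_sliceIncl (z : W n k Q) {q : Q} (hq : z.proj = q)
    (α : Fin k → (Mdl n →L[ℝ] ℝ)) (u : Fin k → Mdl n) :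
    extChartAt (IW n k) z (sliceIncl q α u) = (extChartAt (𝓡 n) q q, u, α) := by
  subst hq
  rw [extChartAt_whitney_apply]
  refine Prod.ext rfl (Prod.ext ?_ ?_)
  · funext A
    exact tangentCoordChange_self (mem_extChartAt_source z.proj)
  · funext A
    ext w
    exact congrArg (α A) (tangentCoordChange_self (mem_extChartAt_source z.proj))

theorem contMDiff_sliceIncl (q : Q) (α : Fin k → (Mdl n →L[ℝ] ℝ)) :
    ContMDiff 𝓘(ℝ, Fin k → Mdl n) (IW n k) ∞
      (sliceIncl q α : (Fin k → Mdl n) → W n k Q) := by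
  intro u₀
  rw [contMDiffAt_totalSpace]
  refine ⟨contMDiffAt_const, ?_⟩
  have h : ContMDiffAt 𝓘(ℝ, Fin k → Mdl n)
      𝓘(ℝ, (Fin k → Mdl n) × (Fin k → (Mdl n →L[ℝ] ℝ))) ∞
      (fun u => (u, α)) u₀ :=
    (contDiffAt_id.prodMk contDiffAt_const).contMDiffAt
  refine h.congr_of_eventuallyEq (Eventually.of_forall fun u => ?_)
  have := congrArg Prod.snd (extChartAt_sliceIncl (sliceIncl q α u₀) rfl α u)
  rw [extChartAt_whitney_apply] at this
  exact this

/-- The model of `(θ₀)_A` on `ℝⁿ × ((ℝⁿ)*)ᵏ`, namely `p^A_i dq^i`. -/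
noncomputable def liouvilleModel (A : Fin k) (y : PhaseModel n k) : PhaseModel n k →L[ℝ] ℝ :=
  (y.2 A).comp (ContinuousLinearMap.fst ℝ _ _)

theorem liouvilleModel_apply (A : Fin k) (y w : PhaseModel n k) :
    liouvilleModel A y w = y.2 A w.1 := rfl

theorem differentiableAt_liouvilleModel (A : Fin k) (y : PhaseModel n k) :
    DifferentiableAt ℝ (liouvilleModel A) y := by
  unfold liouvilleModel
  fun_prop

theorem fderiv_liouvilleModel_apply (A : Fin k) (y u w : PhaseModel n k) :
    fderiv ℝ (liouvilleModel A) y u w = u.2 A w.1 := by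
  have h1 : fderiv ℝ (liouvilleModel A) y u w = fderiv ℝ (fun y => liouvilleModel A y w) y u := by
    rw [fderiv_clm_apply (differentiableAt_liouvilleModel A y) (differentiableAt_const w)]
    simp
  let l : PhaseModel n k →L[ℝ] ℝ := (ContinuousLinearMap.apply ℝ ℝ w.1).comp
    ((ContinuousLinearMap.proj (R := ℝ) (φ := fun _ : Fin k => (Mdl n →L[ℝ] ℝ)) A).comp
      (ContinuousLinearMap.snd ℝ (Mdl n) _))
  have h2 : (fun y => liouvilleModel A y w) = l := rfl
  rw [h1, h2, l.fderiv]
  rfl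

/-- On the domain of a chart, `(θ₀)_A = p^A_i dq^i`: the change of coordinates of the covector
cancels that of the tangent vector. -/
theorem theta0_eq_pullback (A : Fin k) {α₀ α : T1s n k Q}
    (hα : α ∈ (extChartAt (IC n k) α₀).source) :
    theta0 A α = (liouvilleModel A (extChartAt (IC n k) α₀ α)).comp
      (mfderiv (IC n k) 𝓘(ℝ, PhaseModel n k) (extChartAt (IC n k) α₀) α) := by
  have hq := mem_extChartAt_cov_source.1 hα
  have hχ : MDifferentiableAt (IC n k) 𝓘(ℝ, PhaseModel n k)
      (extChartAt (IC n k) α₀) α := mdifferentiableAt_extChartAt (by rwa [extChartAt_source] at hα)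
  have hc : MDifferentiableAt (𝓡 n) 𝓘(ℝ, Mdl n) (extChartAt (𝓡 n) α₀.proj) α.proj :=
    mdifferentiableAt_extChartAt (by rwa [extChartAt_source] at hq)
  have hp : MDifferentiableAt (IC n k) (𝓡 n) (fun β : T1s n k Q => β.proj) α :=
    (contMDiff_proj (n := ∞) (CovFiber n k Q)).mdifferentiableAt (by simp)
  have hfst : (fun y : PhaseModel n k => y.1) ∘ extChartAt (IC n k) α₀ =
      extChartAt (𝓡 n) α₀.proj ∘ (fun β : T1s n k Q => β.proj) := by
    funext β
    simp only [Function.comp, extChartAt_cov_apply]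
  have hd : mfderiv (IC n k) 𝓘(ℝ, Mdl n)
      ((fun y : PhaseModel n k => y.1) ∘ extChartAt (IC n k) α₀) α = mfderiv (IC n k) 𝓘(ℝ, Mdl n)
      (extChartAt (𝓡 n) α₀.proj ∘ (fun β : T1s n k Q => β.proj)) α := by rw [hfst]
  rw [mfderiv_comp α (I' := 𝓘(ℝ, PhaseModel n k))
      (differentiableAt_fst.mdifferentiableAt) hχ, mfderiv_comp α hc hp,
    mfderiv_extChartAt_eq_tangentCoordChange hq, mfderiv_eq_fderiv, fderiv_fst] at hd
  ext w
  have hw : (mfderiv (IC n k) 𝓘(ℝ, PhaseModel n k) (extChartAt (IC n k) α₀) α w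
      : PhaseModel n k).1 = tangentCoordChange (𝓡 n) α.proj α₀.proj α.proj
        (mfderiv (IC n k) (𝓡 n) (fun β : T1s n k Q => β.proj) α w) := DFunLike.congr_fun hd w
  have e1 : (extChartAt (IC n k) α₀ α).2 A =
    (cov α A).comp (tangentCoordChange (𝓡 n) α₀.proj α.proj α.proj) := by
      rw [extChartAt_cov_apply]
  refine Eq.trans ?_ (liouvilleModel_apply A (extChartAt (IC n k) α₀ α)
    (mfderiv (IC n k) 𝓘(ℝ, PhaseModel n k) (extChartAt (IC n k) α₀) α w)).symm
  rw [hw, e1]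
  exact (congrArg (cov α A) (tangentCoordChange_inverse' hq _)).symm

theorem chartForm_theta0 (A : Fin k) (α₀ : T1s n k Q) {y : PhaseModel n k}
    (hy : y ∈ (extChartAt (IC n k) α₀).target) :
    chartForm (IC n k) α₀ (theta0 A) y = liouvilleModel A y := by
  rw [chartForm, theta0_eq_pullback A ((extChartAt (IC n k) α₀).map_target hy)]
  have h := mfderiv_extChartAt_comp_mfderivWithin_extChartAt_symm hy
  rw [ModelWithCorners.range_eq_univ, mfderivWithin_univ] at h
  refine ContinuousLinearMap.ext fun w => ?_
  have hw := DFunLike.congr_fun h w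
  have e : extChartAt (IC n k) α₀ ((extChartAt (IC n k) α₀).symm y) = y :=
    (extChartAt (IC n k) α₀).right_inv hy
  have e2 : ∀ a b w w', a = b → w = w' → liouvilleModel (n := n) A a w = liouvilleModel A b w' := by
    rintro a _ w _ rfl rfl; rfl
  exact e2 _ _ _ _ e hw

theorem differentiableAt_chartForm_theta0 (A : Fin k) (α₀ : T1s n k Q) :
    DifferentiableAt ℝ (chartForm (IC n k) α₀ (theta0 A)) (extChartAt (IC n k) α₀ α₀) := by
  refine (differentiableAt_liouvilleModel A _).congr_of_eventuallyEq ?_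
  filter_upwards [extChartAt_target_mem_nhds (I := IC n k) α₀] with y hy
  exact chartForm_theta0 A α₀ hy

/-- The model of `(ω₀)_A` on `ℝⁿ × ((ℝⁿ)*)ᵏ`. -/
noncomputable def omegaModel (A : Fin k) (y : PhaseModel n k) :
    PhaseModel n k [⋀^Fin 2]→L[ℝ] ℝ :=
  -extDerivOneForm 𝓘(ℝ, PhaseModel n k) (liouvilleModel (n := n) A) y

theorem omegaModel_apply (A : Fin k) (y u w : PhaseModel n k) :
    omegaModel A y ![u, w] = w.2 A u.1 - u.2 A w.1 := by
  have h := extDerivOneForm_modelSpace (θ := liouvilleModel (n := n) A) (x := y)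
    (differentiableAt_liouvilleModel A _) u w
  rw [fderiv_liouvilleModel_apply, fderiv_liouvilleModel_apply] at h
  have e : omegaModel A y ![u, w] = -(extDerivOneForm 𝓘(ℝ, PhaseModel n k)
    (liouvilleModel (n := n) A) y ![u, w]) := rfl
  rw [e, h, neg_sub]

/-- The charts of `(T¹ₖ)*Q` are Darboux charts: `(ω₀)_A = dq^i ∧ dp^A_i` on their domains. -/
theorem omega0_eq_pullback (A : Fin k) {α₀ α : T1s n k Q}
    (hα : α ∈ (extChartAt (IC n k) α₀).source) :
    omega0 A α = (omegaModel A (extChartAt (IC n k) α₀ α)).compContinuousLinearMap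
      (mfderiv (IC n k) 𝓘(ℝ, PhaseModel n k) (extChartAt (IC n k) α₀) α) := by
  have hs : (extChartAt (IC n k) α₀).source ∈ 𝓝 α := (isOpen_extChartAt_source α₀).mem_nhds hα
  have h := extDerivOneForm_pullback (I := IC n k) (η := theta0 A) (θ := liouvilleModel (n := n) A)
    (J := 𝓘(ℝ, PhaseModel n k)) (f := extChartAt (IC n k) α₀) (x := α)
    ((contMDiffOn_extChartAt (I := IC n k) (x := α₀)).contMDiffAt
      (by rwa [extChartAt_source] at hs))
    (by filter_upwards [hs] with β hβ using theta0_eq_pullback A hβ)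
    (by rw [chartForm_modelSpace]; exact (differentiableAt_liouvilleModel A _))
  rw [omega0, h]
  rfl

end Coordinates

/-! ### The Legendre map and the Lagrangian forms -/

section Legendre

variable {n k : ℕ} {Q : Type*} [TopologicalSpace Q] [ChartedSpace (Mdl n) Q]
  [IsManifold (𝓡 n) ∞ Q]

/-- The model space of `T¹ₖQ`, with coordinates `(q^i, v^i_A)`. -/
abbrev VelModel (n k : ℕ) : Type := Mdl n × (Fin k → Mdl n)

/-- The Lagrangian `L` in the chart of `T¹ₖQ` around `v₀`. -/
noncomputable def localLagrangian (L : T1 n k Q → ℝ) (v₀ : T1 n k Q) (y : VelModel n k) : ℝ :=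
  L ((extChartAt (IV n k) v₀).symm y)

/-- The partial derivative `∂ℓ/∂v` of a function of `(q, v)`. -/
noncomputable def velDeriv (l : VelModel n k → ℝ) (y : VelModel n k) : (Fin k → Mdl n) →L[ℝ] ℝ :=
  (fderiv ℝ l y).comp (ContinuousLinearMap.inr ℝ (Mdl n) (Fin k → Mdl n))

/-- The Legendre map `(q, v) ↦ (q, ∂ℓ/∂v)` of a function of `(q, v)`. -/
noncomputable def localLegendre (l : VelModel n k → ℝ) (y : VelModel n k) : PhaseModel n k :=
  (y.1, fun A => (velDeriv l y).comp (ContinuousLinearMap.single ℝ (fun _ : Fin k => Mdl n) A))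

variable {L : T1 n k Q → ℝ}

theorem contDiffOn_localLagrangian (hL : ContMDiff (IV n k) 𝓘(ℝ, ℝ) ∞ L) (v₀ : T1 n k Q) :
    ContDiffOn ℝ ∞ (localLagrangian L v₀) (extChartAt (IV n k) v₀).target :=
  (hL.comp_contMDiffOn (contMDiffOn_extChartAt_symm (I := IV n k) v₀)).contDiffOn

theorem extChartAt_vel_symm_apply {v₀ : T1 n k Q} {q : Q}
    (hq : q ∈ (extChartAt (𝓡 n) v₀.proj).source) (u : Fin k → Mdl n) :
    (extChartAt (IV n k) v₀).symm (extChartAt (𝓡 n) v₀.proj q, u) =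
      fibreIncl q (fun A => tangentCoordChange (𝓡 n) v₀.proj q q (u A)) := by
  have h := (extChartAt (IV n k) v₀).left_inv
    (mem_extChartAt_vel_source.2 hq : (fibreIncl q (fun A =>
      tangentCoordChange (𝓡 n) v₀.proj q q (u A)) : T1 n k Q) ∈ _)
  rw [← h, extChartAt_vel_apply]
  refine congrArg _ (Prod.ext rfl (funext fun A => ?_))
  exact (tangentCoordChange_inverse hq (u A)).symm

theorem hasFDerivAt_comp_fibreIncl (hL : ContMDiff (IV n k) 𝓘(ℝ, ℝ) ∞ L) (v : T1 n k Q) :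
    HasFDerivAt (fun u => L (fibreIncl v.proj u)) (fibreDeriv L v) (vel v) :=
  ((hL.comp (contMDiff_fibreIncl v.proj)).contDiff.differentiable (by simp) _).hasFDerivAt

/-- In the chart around `v₀`, the fibre derivative of `L` is `∂ℓ/∂v`. -/
theorem fibreDeriv_comp_coordChange (hL : ContMDiff (IV n k) 𝓘(ℝ, ℝ) ∞ L) {v₀ v : T1 n k Q}
    (hv : v ∈ (extChartAt (IV n k) v₀).source) (u : Fin k → Mdl n) :
    fibreDeriv L v (fun A => tangentCoordChange (𝓡 n) v₀.proj v.proj v.proj (u A)) =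
      velDeriv (localLagrangian L v₀) (extChartAt (IV n k) v₀ v) u := by
  have hq := mem_extChartAt_vel_source.1 hv
  let T : (Fin k → Mdl n) →L[ℝ] (Fin k → Mdl n) := ContinuousLinearMap.pi fun A =>
    (tangentCoordChange (𝓡 n) v₀.proj v.proj v.proj).comp (ContinuousLinearMap.proj A)
  set y := extChartAt (IV n k) v₀ v with hy
  have hy1 : y = (extChartAt (𝓡 n) v₀.proj v.proj, y.2) := by
    rw [hy, extChartAt_vel_apply]
  have hTy : T y.2 = vel v := by
    rw [hy, extChartAt_vel_apply]
    funext A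
    exact tangentCoordChange_inverse' hq (vel v A)
  have hl : HasFDerivAt (localLagrangian L v₀) (fderiv ℝ (localLagrangian L v₀) y) y :=
    (((contDiffOn_localLagrangian hL v₀).contDiffAt
      ((isOpen_extChartAt_target v₀).mem_nhds ((extChartAt (IV n k) v₀).map_source hv))
      ).differentiableAt (by simp)).hasFDerivAt
  have h1 : HasFDerivAt (fun u => localLagrangian L v₀ (extChartAt (𝓡 n) v₀.proj v.proj, u))
      (velDeriv (localLagrangian L v₀) y) y.2 := by
    have hi : HasFDerivAt (fun u => ((extChartAt (𝓡 n) v₀.proj v.proj, u) : VelModel n k))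
      (ContinuousLinearMap.inr ℝ (Mdl n) (Fin k → Mdl n)) y.2 := hasFDerivAt_prodMk_right _ _
    have hl' : HasFDerivAt (localLagrangian L v₀) (fderiv ℝ (localLagrangian L v₀) y)
        ((extChartAt (𝓡 n) v₀.proj v.proj, y.2) : VelModel n k) := hy1 ▸ hl
    exact HasFDerivAt.comp y.2 hl' hi
  have h2 : HasFDerivAt (fun u => L (fibreIncl v.proj (T u))) ((fibreDeriv L v).comp T) y.2 := by
    refine HasFDerivAt.comp y.2 (g := fun u => L (fibreIncl v.proj u)) ?_ T.hasFDerivAt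
    rw [hTy]
    exact hasFDerivAt_comp_fibreIncl hL v
  have h3 : (fun u => localLagrangian L v₀ (extChartAt (𝓡 n) v₀.proj v.proj, u)) =
      fun u => L (fibreIncl v.proj (T u)) := by
    funext u
    rw [localLagrangian, extChartAt_vel_symm_apply hq]
    rfl
  rw [h3] at h1
  exact DFunLike.congr_fun (h2.unique h1) u

theorem extChartAt_cov_legendre (hL : ContMDiff (IV n k) 𝓘(ℝ, ℝ) ∞ L) {v₀ v : T1 n k Q}
    (hv : v ∈ (extChartAt (IV n k) v₀).source) :
    extChartAt (IC n k) (legendre L v₀) (legendre L v) =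
      localLegendre (localLagrangian L v₀) (extChartAt (IV n k) v₀ v) := by
  rw [extChartAt_cov_apply]
  refine Prod.ext ?_ ?_
  · rw [localLegendre, extChartAt_vel_apply]; rfl
  · funext A
    ext1 w
    refine Eq.trans ?_ (fibreDeriv_comp_coordChange hL hv (Pi.single A w))
    refine congrArg (fibreDeriv L v) ?_
    funext B
    exact (Pi.apply_single (fun _ => tangentCoordChange (𝓡 n) v₀.proj v.proj v.proj)
      (fun _ => map_zero _) A w B).symm

theorem legendre_eq_symm (hL : ContMDiff (IV n k) 𝓘(ℝ, ℝ) ∞ L) {v₀ v : T1 n k Q}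
    (hv : v ∈ (extChartAt (IV n k) v₀).source) :
    legendre L v = (extChartAt (IC n k) (legendre L v₀)).symm
      (localLegendre (localLagrangian L v₀) (extChartAt (IV n k) v₀ v)) := by
  rw [← extChartAt_cov_legendre hL hv, PartialEquiv.left_inv]
  exact mem_extChartAt_cov_source.2 (mem_extChartAt_vel_source.1 hv)

theorem contDiffOn_velDeriv {l : VelModel n k → ℝ} {s : Set (VelModel n k)} (hs : IsOpen s)
    (hl : ContDiffOn ℝ ∞ l s) : ContDiffOn ℝ ∞ (velDeriv l) s :=
  (hl.fderiv_of_isOpen hs (by simp)).clm_comp contDiffOn_const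

theorem contDiffOn_localLegendre {l : VelModel n k → ℝ} {s : Set (VelModel n k)} (hs : IsOpen s)
    (hl : ContDiffOn ℝ ∞ l s) : ContDiffOn ℝ ∞ (localLegendre l) s :=
  contDiffOn_fst.prodMk (contDiffOn_pi.2 fun _ =>
    (contDiffOn_velDeriv hs hl).clm_comp contDiffOn_const)

theorem contMDiff_legendre (hL : ContMDiff (IV n k) 𝓘(ℝ, ℝ) ∞ L) :
    ContMDiff (IV n k) (IC n k) ∞ (legendre L) := by
  intro v₀
  have hs := extChartAt_source_mem_nhds (I := IV n k) v₀
  have h0 := mem_extChartAt_source (I := IV n k) v₀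
  have h1 : ContMDiffAt (IV n k) 𝓘(ℝ, VelModel n k) ∞ (extChartAt (IV n k) v₀) v₀ :=
    contMDiffAt_extChartAt
  have h2 : ContMDiffAt 𝓘(ℝ, VelModel n k) 𝓘(ℝ, PhaseModel n k) ∞
      (localLegendre (localLagrangian L v₀)) (extChartAt (IV n k) v₀ v₀) :=
    ((contDiffOn_localLegendre (isOpen_extChartAt_target v₀)
      (contDiffOn_localLagrangian hL v₀)).contDiffAt
        (extChartAt_target_mem_nhds (I := IV n k) v₀)).contMDiffAt
  have h3 : ContMDiffAt 𝓘(ℝ, PhaseModel n k) (IC n k) ∞ (extChartAt (IC n k) (legendre L v₀)).symm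
      (localLegendre (localLagrangian L v₀) (extChartAt (IV n k) v₀ v₀)) := by
    rw [← extChartAt_cov_legendre hL h0]
    exact (contMDiffOn_extChartAt_symm _).contMDiffAt (extChartAt_target_mem_nhds _)
  refine ((h3.comp v₀ (h2.comp v₀ h1))).congr_of_eventuallyEq ?_
  filter_upwards [hs] with v hv using legendre_eq_symm hL hv

theorem energy_eq (hL : ContMDiff (IV n k) 𝓘(ℝ, ℝ) ∞ L) (v : T1 n k Q) :
    energy L v = fibreDeriv L v (vel v) - L v := by
  let u : Fin k → Mdl n := vel v
  have h1 : HasDerivAt (fun s : ℝ => Real.exp s • u) u 0 := by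
    have := (Real.hasDerivAt_exp 0).smul_const u
    rwa [Real.exp_zero, one_smul] at this
  have h2 : HasFDerivAt (fun u => L (fibreIncl v.proj u)) (fibreDeriv L v) (Real.exp 0 • u) := by
    rw [Real.exp_zero, one_smul]
    exact hasFDerivAt_comp_fibreIncl hL v
  have h3 := h2.comp_hasDerivAt (0 : ℝ) h1
  exact congrArg (· - L v) h3.deriv

theorem energy_eq_coord (hL : ContMDiff (IV n k) 𝓘(ℝ, ℝ) ∞ L) {v₀ v : T1 n k Q}
    (hv : v ∈ (extChartAt (IV n k) v₀).source) :
    energy L v = velDeriv (localLagrangian L v₀) (extChartAt (IV n k) v₀ v)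
      (extChartAt (IV n k) v₀ v).2 - L v := by
  rw [energy_eq hL, ← fibreDeriv_comp_coordChange hL hv, extChartAt_vel_apply]
  congr 2
  funext A
  exact (tangentCoordChange_inverse' (mem_extChartAt_vel_source.1 hv) (vel v A)).symm

theorem contMDiff_energy (hL : ContMDiff (IV n k) 𝓘(ℝ, ℝ) ∞ L) :
    ContMDiff (IV n k) 𝓘(ℝ, ℝ) ∞ (energy L) := by
  intro v₀
  have hs := extChartAt_source_mem_nhds (I := IV n k) v₀
  have h1 : ContMDiffAt (IV n k) 𝓘(ℝ, VelModel n k) ∞ (extChartAt (IV n k) v₀) v₀ :=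
    contMDiffAt_extChartAt
  have h2 : ContMDiffAt 𝓘(ℝ, VelModel n k) 𝓘(ℝ, ℝ) ∞
      (fun y : VelModel n k => velDeriv (localLagrangian L v₀) y y.2)
        (extChartAt (IV n k) v₀ v₀) :=
    (((contDiffOn_velDeriv (isOpen_extChartAt_target v₀)
      (contDiffOn_localLagrangian hL v₀)).contDiffAt
        (extChartAt_target_mem_nhds (I := IV n k) v₀)).clm_apply contDiffAt_snd).contMDiffAt
  refine ((h2.comp v₀ h1).sub hL.contMDiffAt).congr_of_eventuallyEq ?_
  filter_upwards [hs] with v hv using energy_eq_coord hL hv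

/-- `(θ_L)_A` is the pull-back of `(θ₀)_A` by the Legendre map. -/
theorem thetaL_eq_pullback (hL : ContMDiff (IV n k) 𝓘(ℝ, ℝ) ∞ L) (A : Fin k) (v : T1 n k Q) :
    thetaL L A v = (theta0 A (legendre L v)).comp
      (mfderiv (IV n k) (IC n k) (legendre L) v) := by
  have hp : MDifferentiableAt (IC n k) (𝓡 n) (fun β : T1s n k Q => β.proj) (legendre L v) :=
    (contMDiff_proj (n := ∞) (CovFiber n k Q)).mdifferentiableAt (by simp)
  have hF : MDifferentiableAt (IV n k) (IC n k) (legendre L) v :=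
    (contMDiff_legendre hL).mdifferentiableAt (by simp)
  have h1 : mfderiv (IV n k) (𝓡 n) (fun u : T1 n k Q => u.proj) v =
      (mfderiv (IC n k) (𝓡 n) (fun β : T1s n k Q => β.proj) (legendre L v)).comp
        (mfderiv (IV n k) (IC n k) (legendre L) v) := mfderiv_comp v hp hF
  let u : Fin k → Mdl n := vel v
  let D : (Fin k → Mdl n) →L[ℝ] TangentSpace (IV n k) v :=
    mfderiv 𝓘(ℝ, Fin k → Mdl n) (IV n k) (fibreIncl v.proj) (vel v)
  have h2 : fibreDeriv L v = (mfderiv (IV n k) 𝓘(ℝ, ℝ) L v).comp D := by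
    have h := mfderiv_comp (I := 𝓘(ℝ, Fin k → Mdl n)) (I' := IV n k) (I'' := 𝓘(ℝ, ℝ))
      (g := L) (f := fibreIncl v.proj) u (hL.mdifferentiableAt (by simp))
      ((contMDiff_fibreIncl v.proj).mdifferentiableAt (by simp))
    rw [mfderiv_eq_fderiv] at h
    exact h
  have e2 : theta0 A (legendre L v) = ((fibreDeriv L v).comp
      (ContinuousLinearMap.single ℝ (fun _ : Fin k => Mdl n) A)).comp
      (mfderiv (IC n k) (𝓡 n) (fun β : T1s n k Q => β.proj) (legendre L v)) := rfl
  rw [e2, h2, thetaL, tangentStructure, h1]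
  rfl

/-- `(ω_L)_A` is the pull-back of `(ω₀)_A` by the Legendre map. -/
theorem omegaL_eq_pullback (hL : ContMDiff (IV n k) 𝓘(ℝ, ℝ) ∞ L) (A : Fin k) (v : T1 n k Q) :
    omegaL L A v = (omega0 A (legendre L v)).compContinuousLinearMap
      (mfderiv (IV n k) (IC n k) (legendre L) v) := by
  rw [omegaL, extDerivOneForm_pullback (contMDiff_legendre hL v)
    (Eventually.of_forall (thetaL_eq_pullback hL A)) (differentiableAt_chartForm_theta0 A _)]
  rfl

end Legendre

/-! ### The unified Hamiltonian on the Whitney sum -/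

section Unified

variable {n k : ℕ} {Q : Type*} [TopologicalSpace Q] [ChartedSpace (Mdl n) Q]
  {L : T1 n k Q → ℝ}

theorem eq_graphMap_pr1 {z : W n k Q} (hz : z ∈ graphSet L) : graphMap L (pr1 z) = z := by
  obtain ⟨q, v, α⟩ := z
  have h : (⟨q, α⟩ : T1s n k Q) = ⟨q, (legendre L (mkVel q v)).snd⟩ := hz
  have h2 : α = (legendre L (mkVel q v)).snd := by
    injection h with _ h'
  rw [h2]
  rfl

variable [IsManifold (𝓡 n) ∞ Q]

/-- The model space of the Whitney sum, with coordinates `(q^i, v^i_A, p^A_i)`. -/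
abbrev WhitneyModel (n k : ℕ) : Type := Mdl n × ((Fin k → Mdl n) × (Fin k → (Mdl n →L[ℝ] ℝ)))

theorem coupling_eq_coord {z₀ z : W n k Q} (hz : z ∈ (extChartAt (IW n k) z₀).source) :
    coupling z = ∑ A, (extChartAt (IW n k) z₀ z).2.2 A ((extChartAt (IW n k) z₀ z).2.1 A) := by
  rw [extChartAt_whitney_apply]
  refine Finset.sum_congr rfl fun A _ => ?_
  exact (congrArg (cov (pr2 z) A)
    (tangentCoordChange_inverse' (mem_extChartAt_whitney_source.1 hz) (vel (pr1 z) A))).symm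

theorem contMDiff_coupling : ContMDiff (IW n k) 𝓘(ℝ, ℝ) ∞ (coupling : W n k Q → ℝ) := by
  intro z₀
  have h1 : ContMDiffAt (IW n k) 𝓘(ℝ, WhitneyModel n k) ∞ (extChartAt (IW n k) z₀) z₀ :=
    contMDiffAt_extChartAt
  have h2 : ContDiff ℝ ∞ (fun y : WhitneyModel n k => ∑ A, y.2.2 A (y.2.1 A)) := by fun_prop
  refine (h2.contMDiff.contMDiffAt.comp z₀ h1).congr_of_eventuallyEq ?_
  filter_upwards [extChartAt_source_mem_nhds (I := IW n k) z₀] with z hz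
    using coupling_eq_coord hz

theorem contMDiff_unifiedHamiltonian (hL : ContMDiff (IV n k) 𝓘(ℝ, ℝ) ∞ L) :
    ContMDiff (IW n k) 𝓘(ℝ, ℝ) ∞ (unifiedHamiltonian L) :=
  contMDiff_coupling.sub (hL.comp contMDiff_pr1)

theorem contMDiff_graphMap (hL : ContMDiff (IV n k) 𝓘(ℝ, ℝ) ∞ L) :
    ContMDiff (IV n k) (IW n k) ∞ (graphMap L) := by
  intro v₀
  have h1 : ContMDiffAt (IV n k) (IV n k) ∞ (fun v : T1 n k Q => v) v₀ := contMDiffAt_id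
  have h2 := contMDiff_legendre hL v₀
  rw [contMDiffAt_totalSpace] at h1 h2 ⊢
  exact ⟨h1.1, h1.2.prodMk_space h2.2⟩

theorem unifiedHamiltonian_graphMap (hL : ContMDiff (IV n k) 𝓘(ℝ, ℝ) ∞ L) (v : T1 n k Q) :
    unifiedHamiltonian L (graphMap L v) = energy L v := by
  rw [energy_eq hL]
  refine congrArg (· - L v) ?_
  have e : coupling (graphMap L v) = ∑ A, fibreDeriv L v (Pi.single A (vel v A)) := rfl
  rw [e, ← map_sum]
  exact congrArg _ (Finset.univ_sum_single (vel v : Fin k → Mdl n))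

theorem mfderiv_pr2_graphMap (hL : ContMDiff (IV n k) 𝓘(ℝ, ℝ) ∞ L) (v : T1 n k Q)
    (X : TangentSpace (IV n k) v) :
    mfderiv (IW n k) (IC n k) pr2 (graphMap L v) (mfderiv (IV n k) (IW n k) (graphMap L) v X) =
      mfderiv (IV n k) (IC n k) (legendre L) v X :=
  (DFunLike.congr_fun (mfderiv_comp v (contMDiff_pr2.mdifferentiableAt (by simp))
    ((contMDiff_graphMap hL).mdifferentiableAt (by simp))) X).symm

theorem mfderiv_pr1_graphMap (hL : ContMDiff (IV n k) 𝓘(ℝ, ℝ) ∞ L) (v : T1 n k Q)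
    (X : TangentSpace (IV n k) v) :
    mfderiv (IW n k) (IV n k) pr1 (graphMap L v) (mfderiv (IV n k) (IW n k) (graphMap L) v X) =
      X := by
  have h := DFunLike.congr_fun (mfderiv_comp v (contMDiff_pr1.mdifferentiableAt (by simp))
    ((contMDiff_graphMap hL).mdifferentiableAt (by simp))) X
  have e : (pr1 : W n k Q → T1 n k Q) ∘ graphMap L = id := rfl
  rw [e, mfderiv_id] at h
  exact h.symm

/-- The kernel of `pr2_*` consists of the vectors tangent to the slices `u ↦ (u, α)`. -/
theorem exists_mfderiv_sliceIncl_eq (z : W n k Q) (Y : TangentSpace (IW n k) z)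
    (hY : mfderiv (IW n k) (IC n k) pr2 z Y = 0) :
    ∃ w : Fin k → Mdl n, (mfderiv 𝓘(ℝ, Fin k → Mdl n) (IW n k)
      (sliceIncl z.proj (cov (pr2 z))) (vel (pr1 z)) w : WhitneyModel n k) = Y := by
  have hχ : MDifferentiableAt (IW n k) 𝓘(ℝ, WhitneyModel n k) (extChartAt (IW n k) z) z :=
    mdifferentiableAt_extChartAt (mem_chart_source _ _)
  have hχ2 : MDifferentiableAt (IC n k) 𝓘(ℝ, PhaseModel n k) (extChartAt (IC n k) (pr2 z))
    (pr2 z) := mdifferentiableAt_extChartAt (mem_chart_source _ _)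
  let P : WhitneyModel n k →L[ℝ] PhaseModel n k :=
    (ContinuousLinearMap.fst ℝ _ _).prod ((ContinuousLinearMap.snd ℝ _ _).comp
      (ContinuousLinearMap.snd ℝ _ _))
  have hcomp : P ∘ extChartAt (IW n k) z = extChartAt (IC n k) (pr2 z) ∘ pr2 := by
    funext y
    simp only [Function.comp, extChartAt_whitney_apply, extChartAt_cov_apply]
    rfl
  let D : WhitneyModel n k →L[ℝ] WhitneyModel n k :=
    mfderiv (IW n k) 𝓘(ℝ, WhitneyModel n k) (extChartAt (IW n k) z) z
  have hinj : Function.Injective D :=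
    (isInvertible_mfderiv_extChartAt (mem_extChartAt_source (I := IW n k) z)).injective
  have hPY : P (D Y) = 0 := by
    have h1 := DFunLike.congr_fun (mfderiv_comp z (I' := 𝓘(ℝ, WhitneyModel n k))
      (I'' := 𝓘(ℝ, PhaseModel n k)) P.differentiableAt.mdifferentiableAt hχ) Y
    have h2 := DFunLike.congr_fun (mfderiv_comp z hχ2
      (contMDiff_pr2.mdifferentiableAt (by simp))) Y
    rw [hcomp, mfderiv_eq_fderiv, P.fderiv] at h1
    refine (h1.symm.trans h2).trans ?_
    exact (congrArg _ hY).trans (ContinuousLinearMap.map_zero _)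
  refine ⟨(D Y).2.1, hinj ?_⟩
  let j : (Fin k → Mdl n) → W n k Q := sliceIncl z.proj (cov (pr2 z))
  let u : Fin k → Mdl n := vel (pr1 z)
  let c : Mdl n := extChartAt (𝓡 n) z.proj z.proj
  let α : Fin k → (Mdl n →L[ℝ] ℝ) := cov (pr2 z)
  have hj : extChartAt (IW n k) z ∘ j = fun u => ((c, u, α) : WhitneyModel n k) :=
    funext fun u => extChartAt_sliceIncl z rfl _ u
  have hd : HasFDerivAt (fun u : Fin k → Mdl n => ((c, u, α) : WhitneyModel n k))
      ((0 : (Fin k → Mdl n) →L[ℝ] Mdl n).prod ((ContinuousLinearMap.id ℝ (Fin k → Mdl n)).prod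
        (0 : (Fin k → Mdl n) →L[ℝ] (Fin k → (Mdl n →L[ℝ] ℝ))))) u :=
    (hasFDerivAt_const c u).prodMk ((hasFDerivAt_id u).prodMk (hasFDerivAt_const α u))
  have h3 := DFunLike.congr_fun (mfderiv_comp (I := 𝓘(ℝ, Fin k → Mdl n)) (f := j) u hχ
      ((contMDiff_sliceIncl z.proj (cov (pr2 z))).mdifferentiableAt (by simp))) (D Y).2.1
  rw [hj, mfderiv_eq_fderiv, hd.fderiv] at h3
  refine (h3.symm).trans ?_
  exact Prod.ext (congrArg Prod.fst hPY).symm (Prod.ext rfl (congrArg Prod.snd hPY).symm)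

/-- Along the graph of the Legendre map, `d(coupling - L ∘ pr1)` vanishes on `ker pr2_*`: its
component along `dv^i_A` is `p^A_i - ∂L/∂v^i_A`. -/
theorem mfderiv_unifiedHamiltonian_eq_zero (hL : ContMDiff (IV n k) 𝓘(ℝ, ℝ) ∞ L)
    (v : T1 n k Q) (Y : TangentSpace (IW n k) (graphMap L v))
    (hY : mfderiv (IW n k) (IC n k) pr2 (graphMap L v) Y = 0) :
    mfderiv (IW n k) 𝓘(ℝ, ℝ) (unifiedHamiltonian L) (graphMap L v) Y = 0 := by
  obtain ⟨w, rfl⟩ := exists_mfderiv_sliceIncl_eq _ Y hY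
  let α : Fin k → (Mdl n →L[ℝ] ℝ) := cov (legendre L v)
  let u : Fin k → Mdl n := vel v
  have h1 := DFunLike.congr_fun (mfderiv_comp (I := 𝓘(ℝ, Fin k → Mdl n))
    (f := sliceIncl v.proj α) u
    ((contMDiff_unifiedHamiltonian hL).mdifferentiableAt (by simp))
    ((contMDiff_sliceIncl v.proj α).mdifferentiableAt (by simp))) w
  refine Eq.trans h1.symm ?_
  let l : (Fin k → Mdl n) →L[ℝ] ℝ := ∑ A, (α A).comp (ContinuousLinearMap.proj A)
  have h2 : unifiedHamiltonian L ∘ sliceIncl v.proj α =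
      fun u => l u - L (fibreIncl v.proj u) := by
    funext u
    have e : unifiedHamiltonian L (sliceIncl v.proj α u) =
      ∑ A, α A (u A) - L (fibreIncl v.proj u) := rfl
    simp [e, l]
  have h3 : HasFDerivAt (fun u => l u - L (fibreIncl v.proj u)) (l - fibreDeriv L v) u :=
    l.hasFDerivAt.sub (hasFDerivAt_comp_fibreIncl hL v)
  rw [h2, mfderiv_eq_fderiv, h3.fderiv]
  have e : l w = ∑ A, fibreDeriv L v (Pi.single A (w A)) := by
    simp only [l, sum_apply]; rfl
  have h4 : l w - fibreDeriv L v w = 0 := by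
    rw [e, ← map_sum, Finset.univ_sum_single, sub_self]
  exact h4

/-- The push-forward of a solution of the Lagrangian equation along the graph map solves the unified
equation. -/
theorem solvesOn_graph (hL : ContMDiff (IV n k) 𝓘(ℝ, ℝ) ∞ L) {U : Set (T1 n k Q)}
    {X : KVectorField (IV n k) (T1 n k Q) k} {Z : KVectorField (IW n k) (W n k Q) k}
    (hsurj : ∀ v ∈ U, Function.Surjective (mfderiv (IV n k) (IC n k) (legendre L) v))
    (hX : SolvesOn (IV n k) (omegaL L) (energy L) X U)
    (hXZ : ∀ v ∈ U, ∀ A, mfderiv (IV n k) (IW n k) (graphMap L) v (X A v) = Z A (graphMap L v)) :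
    SolvesOn (IW n k) OmegaW (unifiedHamiltonian L) Z (graphSet L ∩ pr1 ⁻¹' U) := by
  rintro z ⟨hz, hzU⟩ Y
  obtain ⟨v, hv, rfl⟩ : ∃ v ∈ U, graphMap L v = z := ⟨pr1 z, hzU, eq_graphMap_pr1 hz⟩
  obtain ⟨Y', hY'⟩ := hsurj v hv (mfderiv (IW n k) (IC n k) pr2 (graphMap L v) Y)
  -- `Y` and the image of `Y'` under the graph map differ by an element of `ker pr2_*`
  have h1 : mfderiv (IW n k) 𝓘(ℝ, ℝ) (unifiedHamiltonian L) (graphMap L v) Y =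
      mfderiv (IV n k) 𝓘(ℝ, ℝ) (energy L) v Y' := by
    have e : unifiedHamiltonian L ∘ graphMap L = energy L :=
      funext (unifiedHamiltonian_graphMap hL)
    have h2 := DFunLike.congr_fun (mfderiv_comp v
      ((contMDiff_unifiedHamiltonian hL).mdifferentiableAt (by simp))
      ((contMDiff_graphMap hL).mdifferentiableAt (by simp))) Y'
    rw [e] at h2
    have h3 := mfderiv_unifiedHamiltonian_eq_zero hL v
      (Y - mfderiv (IV n k) (IW n k) (graphMap L) v Y')
      (by rw [ContinuousLinearMap.map_sub, mfderiv_pr2_graphMap hL, hY', sub_self])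
    rw [ContinuousLinearMap.map_sub, sub_eq_zero] at h3
    exact h3.trans h2.symm
  rw [h1, ← hX v hv]
  refine Finset.sum_congr rfl fun A _ => ?_
  rw [OmegaW, omegaL_eq_pullback hL, compContinuousLinearMap_pair, compContinuousLinearMap_pair,
    hY', ← hXZ v hv, mfderiv_pr2_graphMap hL]
  rfl

end Unified

/-! ### Partial diffeomorphisms and related vector fields -/

section PartialDiffeo

variable {E : Type*} [NormedAddCommGroup E] [NormedSpace ℝ E]
  {H : Type*} [TopologicalSpace H] {I : ModelWithCorners ℝ E H}
  {M : Type*} [TopologicalSpace M] [ChartedSpace H M]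
  {E' : Type*} [NormedAddCommGroup E'] [NormedSpace ℝ E']
  {H' : Type*} [TopologicalSpace H'] {J : ModelWithCorners ℝ E' H'}
  {N : Type*} [TopologicalSpace N] [ChartedSpace H' N]

/-- The inverse function theorem, with an inverse that is smooth on its whole domain. -/
theorem exists_partialDiffeomorph_of_hasFDerivAt [CompleteSpace E] {f : E → E'} {s : Set E}
    (hs : IsOpen s) (hf : ContDiffOn ℝ ∞ f s) {a : E} (ha : a ∈ s) {f' : E ≃L[ℝ] E'}
    (hf' : HasFDerivAt f (f' : E →L[ℝ] E') a) :
    ∃ R : PartialDiffeomorph 𝓘(ℝ, E) 𝓘(ℝ, E') E E' ∞,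
      a ∈ R.source ∧ R.source ⊆ s ∧ ∀ x, R x = f x := by
  have hfa : ContDiffAt ℝ ∞ f a := hf.contDiffAt (hs.mem_nhds ha)
  let e := hfa.toOpenPartialHomeomorph f hf' (by simp)
  -- the inverse is smooth at the points where the derivative is still invertible
  let t : Set E := s ∩ fderiv ℝ f ⁻¹' range ((↑) : (E ≃L[ℝ] E') → E →L[ℝ] E')
  have ht : IsOpen t := (hf.continuousOn_fderiv_of_isOpen hs (by simp)).isOpen_inter_preimage hs
    ContinuousLinearEquiv.isOpen
  have hat : a ∈ t := ⟨ha, f', hf'.fderiv.symm⟩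
  refine ⟨{ toPartialEquiv := (e.restrOpen t ht).toPartialEquiv
            open_source := (e.restrOpen t ht).open_source
            open_target := (e.restrOpen t ht).open_target
            contMDiffOn_toFun := ?_
            contMDiffOn_invFun := ?_ }, ?_, ?_, fun x => rfl⟩
  · exact (hf.mono fun x hx => hx.2.1).contMDiffOn
  · intro y hy
    have hx : (e.restrOpen t ht).symm y ∈ (e.restrOpen t ht).source :=
      (e.restrOpen t ht).map_target hy
    obtain ⟨g, hg⟩ := hx.2.2
    have hd : ContDiffAt ℝ ∞ f ((e.restrOpen t ht).symm y) :=
      hf.contDiffAt (hs.mem_nhds hx.2.1)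
    refine ContDiffAt.contMDiffAt ?_ |>.contMDiffWithinAt
    refine (e.restrOpen t ht).contDiffAt_symm hy (f₀' := g) ?_ hd
    rw [hg]
    exact (hd.differentiableAt (by simp)).hasFDerivAt
  · exact ⟨hfa.mem_toOpenPartialHomeomorph_source hf' (by simp), hat⟩
  · exact fun x hx => hx.2.1

variable (I) in
/-- The chart around `x` as a diffeomorphism onto an open subset of the model vector space. -/
noncomputable def chartDiffeo [IsManifold I ∞ M] [I.Boundaryless] (x : M) :
    PartialDiffeomorph I 𝓘(ℝ, E) M E ∞ where
  toPartialEquiv := extChartAt I x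
  open_source := isOpen_extChartAt_source x
  open_target := isOpen_extChartAt_target x
  contMDiffOn_toFun := by
    rw [extChartAt_source]; exact contMDiffOn_extChartAt
  contMDiffOn_invFun := contMDiffOn_extChartAt_symm x

theorem surjective_mfderiv_partialDiffeomorph (Φ : PartialDiffeomorph I J M N ∞) {x : M}
    (hx : x ∈ Φ.source) : Function.Surjective (mfderiv I J Φ x) := by
  have h := (PartialDiffeomorph.isLocalDiffeomorphAt (φ := Φ) (hx := hx)
    ..).mfderivToContinuousLinearEquiv_coe (by simp)
  rw [← h]
  exact ContinuousLinearEquiv.surjective _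

variable {k : ℕ} {X : KVectorField I M k} {Y : KVectorField J N k}

/-- The inverse of a diffeomorphism relating `X` to `Y` relates `Y` to `X`. -/
theorem related_symm (Φ : PartialDiffeomorph I J M N ∞)
    (hXY : ∀ x ∈ Φ.source, ∀ A, mfderiv I J Φ x (X A x) = Y A (Φ x)) :
    ∀ y ∈ Φ.target, ∀ A, mfderiv J I Φ.symm y (Y A y) = X A (Φ.symm y) := by
  intro y hy A
  obtain ⟨x, hx, rfl⟩ : ∃ x ∈ Φ.source, Φ x = y :=
    ⟨Φ.symm y, Φ.map_target hy, Φ.right_inv hy⟩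
  have hxx : Φ.symm (Φ x) = x := Φ.left_inv hx
  have hcomp : Φ.symm ∘ Φ =ᶠ[𝓝 x] id := by
    filter_upwards [Φ.open_source.mem_nhds hx] with z hz using Φ.left_inv hz
  have h1 := mfderiv_comp x (Φ.symm.mdifferentiableAt (by simp) (Φ.map_source hx))
    (Φ.mdifferentiableAt (by simp) hx)
  have h2 : mfderiv I I (Φ.symm ∘ Φ) x = mfderiv I I id x := hcomp.mfderiv_eq
  rw [← hXY x hx]
  have h3 := DFunLike.congr_fun (h1.symm.trans (h2.trans mfderiv_id)) (X A x)
  refine Eq.trans h3 ?_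
  have h4 : ∀ a b : M, a = b → (X A a : E) = (X A b : E) := by rintro a _ rfl; rfl
  exact (h4 _ _ hxx).symm

/-- The pull-back of a `k`-vector field by a diffeomorphism, with arbitrary values off the domain. -/
theorem exists_related (Φ : PartialDiffeomorph I J M N ∞) (Y : KVectorField J N k) :
    ∃ X : KVectorField I M k, ∀ x ∈ Φ.source, ∀ A, mfderiv I J Φ x (X A x) = Y A (Φ x) := by
  have h : ∀ A, ∀ x, ∃ v : TangentSpace I x, x ∈ Φ.source → mfderiv I J Φ x v = Y A (Φ x) := by
    intro A x
    by_cases hx : x ∈ Φ.source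
    · obtain ⟨v, hv⟩ := surjective_mfderiv_partialDiffeomorph Φ hx (Y A (Φ x))
      exact ⟨v, fun _ => hv⟩
    · exact ⟨0, fun h => absurd h hx⟩
  choose X hX using h
  exact ⟨X, fun x hx A => hX A x hx⟩

theorem isSmoothOn_iff_of_related [IsManifold I ∞ M] [IsManifold J ∞ N]
    (Φ : PartialDiffeomorph I J M N ∞)
    (hXY : ∀ x ∈ Φ.source, ∀ A, mfderiv I J Φ x (X A x) = Y A (Φ x)) :
    IsSmoothOn I X Φ.source ↔ IsSmoothOn J Y Φ.target :=
  ⟨fun h => h.map Φ.open_source Φ.contMDiffOn_toFun Φ.contMDiffOn_invFun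
    Φ.mapsTo_symm (fun _ hy => Φ.right_inv hy) hXY,
  fun h => h.map Φ.open_target Φ.contMDiffOn_invFun Φ.contMDiffOn_toFun
    Φ.mapsTo (fun _ hy => Φ.left_inv hy) (related_symm Φ hXY)⟩

end PartialDiffeo

/-! ### Solutions of the field equation in Darboux coordinates -/

section Darboux

variable {n k : ℕ}

/-- The `A`-th component of a solution of `∑_A i_{X_A} (dq^i ∧ dp^A_i) = dh` on `ℝⁿ × ((ℝⁿ)*)ᵏ`:
its `q^i`-component is `∂h/∂p^A_i`, and its only non-zero `p`-component, the one along `p^A`, is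
`-(1/k) ∂h/∂q`. -/
noncomputable def hamiltonField (h : PhaseModel n k → ℝ) (A : Fin k) (y : PhaseModel n k) :
    PhaseModel n k :=
  (∑ i, fderiv ℝ h y (0, Pi.single A (EuclideanSpace.proj i)) • EuclideanSpace.single i (1 : ℝ),
    ContinuousLinearMap.single ℝ (fun _ : Fin k => Mdl n →L[ℝ] ℝ) A
      ((-(k : ℝ)⁻¹) • (fderiv ℝ h y).comp (ContinuousLinearMap.inl ℝ _ _)))

theorem contDiffOn_hamiltonField {h : PhaseModel n k → ℝ} {s : Set (PhaseModel n k)}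
    (hs : IsOpen s) (hh : ContDiffOn ℝ ∞ h s) (A : Fin k) :
    ContDiffOn ℝ ∞ (hamiltonField h A) s := by
  have hd : ContDiffOn ℝ ∞ (fderiv ℝ h) s := hh.fderiv_of_isOpen hs (by simp)
  refine ContDiffOn.prodMk ?_ ?_
  · exact ContDiffOn.sum fun i _ => (hd.clm_apply contDiffOn_const).smul contDiffOn_const
  · exact (ContinuousLinearMap.contDiff _).comp_contDiffOn
      ((hd.clm_comp contDiffOn_const).const_smul _)

/-- A covector in the basis dual to the standard basis. -/
theorem covector_eq_sum (p : Mdl n →L[ℝ] ℝ) :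
    p = ∑ i, p (EuclideanSpace.single i (1 : ℝ)) • EuclideanSpace.proj i := by
  ext w
  have hw : w = ∑ i, w i • EuclideanSpace.single i (1 : ℝ) := by
    ext j
    simp [Pi.single_apply]
  conv_lhs => rw [hw]
  simp [mul_comm]

theorem sum_omegaModel_hamiltonField (hk : 1 ≤ k) (h : PhaseModel n k → ℝ)
    (y η : PhaseModel n k) :
    ∑ A, omegaModel A y ![hamiltonField h A y, η] = fderiv ℝ h y η := by
  have hk' : (k : ℝ) ≠ 0 := by positivity
  let D : (Fin k → (Mdl n →L[ℝ] ℝ)) →L[ℝ] ℝ :=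
    (fderiv ℝ h y).comp (ContinuousLinearMap.inr ℝ (Mdl n) (Fin k → (Mdl n →L[ℝ] ℝ)))
  have h1 : ∀ A, omegaModel A y ![hamiltonField h A y, η] =
      D (Pi.single A (η.2 A)) + (k : ℝ)⁻¹ * fderiv ℝ h y (η.1, 0) := by
    intro A
    rw [omegaModel_apply]
    have e1 : η.2 A (hamiltonField h A y).1 = D (Pi.single A (η.2 A)) := by
      let S : (Mdl n →L[ℝ] ℝ) →L[ℝ] ℝ :=
        D.comp (ContinuousLinearMap.single ℝ (fun _ : Fin k => Mdl n →L[ℝ] ℝ) A)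
      have e3 : D (Pi.single A (η.2 A)) = S (η.2 A) := rfl
      have e4 : (hamiltonField h A y).1 =
        ∑ i, S (EuclideanSpace.proj i) • EuclideanSpace.single i (1 : ℝ) := rfl
      rw [e3, e4, map_sum]
      conv_rhs => rw [covector_eq_sum (η.2 A), map_sum]
      exact Finset.sum_congr rfl fun i _ => by
        rw [map_smul, map_smul, smul_eq_mul, smul_eq_mul, mul_comm]
    have e2 : (hamiltonField h A y).2 A η.1 = -((k : ℝ)⁻¹ * fderiv ℝ h y (η.1, 0)) := by
      simp [hamiltonField]
    rw [e1, e2, sub_neg_eq_add]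
  have h2 : D η.2 + fderiv ℝ h y (η.1, 0) = fderiv ℝ h y η := by
    have : D η.2 = fderiv ℝ h y (0, η.2) := rfl
    rw [this, ← map_add]
    simp
  rw [Finset.sum_congr rfl fun A _ => h1 A, Finset.sum_add_distrib, ← map_sum,
    Finset.univ_sum_single, ← h2]
  simp [hk']

/-- The field equation for `(w, e)` has a smooth solution on the domain of coordinates in which the
`w A` are `dq^i ∧ dp^A_i`. -/
theorem exists_solution_of_darboux (hk : 1 ≤ k)
    {E : Type*} [NormedAddCommGroup E] [NormedSpace ℝ E]
    {H : Type*} [TopologicalSpace H] {I : ModelWithCorners ℝ E H}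
    {M : Type*} [TopologicalSpace M] [ChartedSpace H M] [IsManifold I ∞ M]
    (Ψ : PartialDiffeomorph I 𝓘(ℝ, PhaseModel n k) M (PhaseModel n k) ∞)
    {w : Fin k → ∀ x : M, TangentSpace I x [⋀^Fin 2]→L[ℝ] ℝ}
    (hw : ∀ x ∈ Ψ.source, ∀ A, w A x = (omegaModel A (Ψ x)).compContinuousLinearMap
      (mfderiv I 𝓘(ℝ, PhaseModel n k) Ψ x))
    {e : M → ℝ} (he : ContMDiffOn I 𝓘(ℝ, ℝ) ∞ e Ψ.source) :
    ∃ X : KVectorField I M k, IsSmoothOn I X Ψ.source ∧ SolvesOn I w e X Ψ.source := by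
  let h : PhaseModel n k → ℝ := e ∘ Ψ.symm
  have hh : ContDiffOn ℝ ∞ h Ψ.target :=
    (he.comp Ψ.contMDiffOn_invFun Ψ.mapsTo_symm).contDiffOn
  let Y : KVectorField 𝓘(ℝ, PhaseModel n k) (PhaseModel n k) k := hamiltonField h
  obtain ⟨X, hX⟩ := exists_related Ψ Y
  have hY : IsSmoothOn 𝓘(ℝ, PhaseModel n k) Y Ψ.target := fun A =>
    contMDiffOn_vectorSpace_iff_contDiffOn.2 (contDiffOn_hamiltonField Ψ.open_target hh A)
  refine ⟨X, (isSmoothOn_iff_of_related Ψ hX).2 hY, ?_⟩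
  refine (solvesOn_iff_of_related (f := Ψ) (σ := omegaModel) (h := h) (t := Ψ.target)
    Ψ.open_source Ψ.image_source_eq_target
    (fun x hx => Ψ.mdifferentiableAt (by simp) hx)
    (fun y hy => ((hh.contDiffAt (Ψ.open_target.mem_nhds hy)).differentiableAt
      (by simp)).mdifferentiableAt)
    (fun x hx => surjective_mfderiv_partialDiffeomorph Ψ hx) hw
    (fun x hx => congrArg e (Ψ.left_inv hx)) hX).2 ?_
  intro y hy η
  rw [mfderiv_eq_fderiv]
  exact sum_omegaModel_hamiltonField hk h y η

end Darboux

/-! ### Regular Lagrangians -/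

section Regular

variable {n k : ℕ} {Q : Type*} [TopologicalSpace Q] [ChartedSpace (Mdl n) Q]
  [IsManifold (𝓡 n) ∞ Q] {L : T1 n k Q → ℝ}

theorem finrank_velModel_eq_phaseModel :
    Module.finrank ℝ (VelModel n k) = Module.finrank ℝ (PhaseModel n k) := by
  have h : Module.finrank ℝ (Mdl n →L[ℝ] ℝ) = n := by
    rw [← (LinearMap.toContinuousLinearMap (𝕜 := ℝ) (E := Mdl n) (F' := ℝ)).finrank_eq]
    simp
  rw [Module.finrank_prod, Module.finrank_prod, Module.finrank_pi_fintype,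
    Module.finrank_pi_fintype]
  simp [h]

theorem eq_sum_smul_single (b : Fin k → Mdl n) :
    b = ∑ a : Fin n × Fin k, b a.2 a.1 • Pi.single a.2 (EuclideanSpace.single a.1 (1 : ℝ)) := by
  have h : ∀ A, ∑ i, b A i • (Pi.single A (EuclideanSpace.single i (1 : ℝ)) : Fin k → Mdl n) =
      Pi.single A (b A) := by
    intro A
    have hb : b A = ∑ i, b A i • EuclideanSpace.single i (1 : ℝ) := by
      ext j
      simp [Pi.single_apply]
    have := congrArg (LinearMap.single ℝ (fun _ : Fin k => Mdl n) A) hb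
    rw [map_sum] at this
    refine Eq.trans ?_ this.symm
    exact Finset.sum_congr rfl fun i _ => by rw [map_smul]; rfl
  rw [Fintype.sum_prod_type_right]
  simp only [h]
  exact (Finset.univ_sum_single b).symm

/-- For a regular Lagrangian the fibre Hessian at `v`, in the chart around `v`, has trivial kernel:
the matrix of the hypothesis is the matrix of this bilinear form in the standard basis of
`(ℝⁿ)ᵏ`. -/
theorem eq_zero_of_hessian_eq_zero (hL : ContMDiff (IV n k) 𝓘(ℝ, ℝ) ∞ L)
    (hreg : IsRegularLagrangian L) (v : T1 n k Q) (b : Fin k → Mdl n)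
    (hb : fderiv ℝ (velDeriv (localLagrangian L v)) (extChartAt (IV n k) v v) (0, b) = 0) :
    b = 0 := by
  set l := localLagrangian L v with hl
  set y := extChartAt (IV n k) v v with hy
  let u₀ : Fin k → Mdl n := vel v
  let c : Mdl n := extChartAt (𝓡 n) v.proj v.proj
  have hchart : ∀ u : Fin k → Mdl n, extChartAt (IV n k) v (fibreIncl v.proj u) = (c, u) := by
    intro u
    rw [extChartAt_vel_apply]
    exact Prod.ext rfl (funext fun A => tangentCoordChange_self (mem_extChartAt_source v.proj))
  have hyc : y = (c, u₀) := hchart u₀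
  have hd : DifferentiableAt ℝ (velDeriv l) y :=
    ((contDiffOn_velDeriv (isOpen_extChartAt_target v)
      (contDiffOn_localLagrangian hL v)).contDiffAt
        (extChartAt_target_mem_nhds (I := IV n k) v)).differentiableAt (by simp)
  have hfib : ∀ u : Fin k → Mdl n, fibreDeriv L (fibreIncl v.proj u) = velDeriv l (c, u) := by
    intro u
    ext1 w
    have h := fibreDeriv_comp_coordChange hL (v₀ := v) (v := fibreIncl v.proj u)
      (mem_extChartAt_vel_source.2 (mem_extChartAt_source v.proj)) w
    rw [hchart] at h
    rw [← h]
    exact congrArg (fibreDeriv L (fibreIncl v.proj u))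
      (funext fun A => (tangentCoordChange_self (mem_extChartAt_source v.proj)).symm)
  have hM : ∀ a w : Fin k → Mdl n,
      fderiv ℝ (fun u => fibreDeriv L (fibreIncl v.proj u) w) u₀ a =
        fderiv ℝ (velDeriv l) y (0, a) w := by
    intro a w
    have e : (fun u => fibreDeriv L (fibreIncl v.proj u) w) = fun u => velDeriv l (c, u) w :=
      funext fun u => by rw [hfib]
    have hi : HasFDerivAt (fun u => ((c, u) : VelModel n k))
      (ContinuousLinearMap.inr ℝ (Mdl n) (Fin k → Mdl n)) u₀ := hasFDerivAt_prodMk_right _ _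
    have h1 : HasFDerivAt (velDeriv l) (fderiv ℝ (velDeriv l) y) ((c, u₀) : VelModel n k) :=
      hyc ▸ hd.hasFDerivAt
    have h2 := (HasFDerivAt.comp u₀ h1 hi).clm_apply (hasFDerivAt_const w u₀)
    rw [e]
    refine (DFunLike.congr_fun h2.fderiv a).trans ?_
    simp
  have hvec : Matrix.vecMul (fun a : Fin n × Fin k => b a.2 a.1)
      (Matrix.of fun (a b : Fin n × Fin k) =>
        fderiv ℝ (fun u => fibreDeriv L (fibreIncl v.proj u)
          (Pi.single b.2 (EuclideanSpace.single b.1 (1 : ℝ)))) (vel v)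
          (Pi.single a.2 (EuclideanSpace.single a.1 (1 : ℝ)))) = 0 := by
    funext j
    let T : (Fin k → Mdl n) →L[ℝ] ℝ := fderiv ℝ (fun u => fibreDeriv L (fibreIncl v.proj u)
      (Pi.single j.2 (EuclideanSpace.single j.1 (1 : ℝ)))) u₀
    have e1 : T b = 0 := by
      refine (hM b _).trans ?_
      rw [hb]; rfl
    have e2 : T b = ∑ a : Fin n × Fin k,
        b a.2 a.1 * T (Pi.single a.2 (EuclideanSpace.single a.1 (1 : ℝ))) := by
      conv_lhs => rw [eq_sum_smul_single b]
      rw [map_sum]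
      exact Finset.sum_congr rfl fun a _ => by rw [map_smul, smul_eq_mul]
    exact e2.symm.trans e1
  have h0 := Matrix.eq_zero_of_vecMul_eq_zero (hreg v) hvec
  funext A
  ext i
  exact congrFun h0 (i, A)

/-- The Legendre map of a regular Lagrangian is a local diffeomorphism. The local inverse is found
in the charts around `v` and `FL v`, whence the bound on the target. -/
theorem exists_partialDiffeomorph_legendre (hL : ContMDiff (IV n k) 𝓘(ℝ, ℝ) ∞ L)
    (hreg : IsRegularLagrangian L) (v : T1 n k Q) :
    ∃ Φ : PartialDiffeomorph (IV n k) (IC n k) (T1 n k Q) (T1s n k Q) ∞,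
      v ∈ Φ.source ∧ EqOn Φ (legendre L) Φ.source ∧
        Φ.target ⊆ (extChartAt (IC n k) (legendre L v)).source := by
  let l := localLagrangian L v
  let y := extChartAt (IV n k) v v
  have hv : v ∈ (extChartAt (IV n k) v).source := mem_extChartAt_source v
  have hy : y ∈ (extChartAt (IV n k) v).target := mem_extChartAt_target v
  have hopen := isOpen_extChartAt_target (I := IV n k) v
  have hd : HasFDerivAt (velDeriv l) (fderiv ℝ (velDeriv l) y) y :=
    (((contDiffOn_velDeriv hopen (contDiffOn_localLagrangian hL v)).contDiffAt
      (hopen.mem_nhds hy)).differentiableAt (by simp)).hasFDerivAt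
  let K : ∀ _ : Fin k, ((Fin k → Mdl n) →L[ℝ] ℝ) →L[ℝ] (Mdl n →L[ℝ] ℝ) := fun A =>
    ContinuousLinearMap.precomp ℝ (ContinuousLinearMap.single ℝ (fun _ : Fin k => Mdl n) A)
  let f' : VelModel n k →L[ℝ] PhaseModel n k := (ContinuousLinearMap.fst ℝ _ _).prod
    (ContinuousLinearMap.pi fun A => (K A).comp (fderiv ℝ (velDeriv l) y))
  have hf' : HasFDerivAt (localLegendre l) f' y :=
    hasFDerivAt_fst.prodMk (hasFDerivAt_pi.2 fun A => (K A).hasFDerivAt.comp y hd)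
  -- `f'` is block triangular: the identity on `q`, the fibre Hessian on `v`
  have hinj : Function.Injective f' := by
    rw [injective_iff_map_eq_zero]
    rintro ⟨a, b⟩ hab
    have ha : a = 0 := congrArg Prod.fst hab
    subst ha
    have hb : b = 0 := by
      refine eq_zero_of_hessian_eq_zero hL hreg v b ?_
      ext1 w
      have hA : ∀ A, fderiv ℝ (velDeriv l) y (0, b) (Pi.single A (w A)) = 0 := fun A =>
        DFunLike.congr_fun (congrFun (congrArg Prod.snd hab) A) (w A)
      rw [← Finset.univ_sum_single w, map_sum]
      exact Finset.sum_eq_zero fun A _ => hA A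
    rw [hb]; rfl
  let e : VelModel n k ≃L[ℝ] PhaseModel n k := (LinearEquiv.ofInjectiveOfFinrankEq
    (f' : VelModel n k →ₗ[ℝ] PhaseModel n k) hinj
    finrank_velModel_eq_phaseModel).toContinuousLinearEquiv
  have he : (e : VelModel n k →L[ℝ] PhaseModel n k) = f' :=
    ContinuousLinearMap.ext fun _ => rfl
  obtain ⟨R, hyR, hRs, hR⟩ := exists_partialDiffeomorph_of_hasFDerivAt hopen
    (contDiffOn_localLegendre hopen (contDiffOn_localLagrangian hL v)) hy (he.symm ▸ hf')
  have heq : ∀ u ∈ (extChartAt (IV n k) v).source, (chartDiffeo (IC n k) (legendre L v)).symm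
      (R (chartDiffeo (IV n k) v u)) = legendre L u := fun u hu =>
    ((legendre_eq_symm hL hu).trans (congrArg _ (hR _).symm)).symm
  refine ⟨(chartDiffeo (IV n k) v).trans (R.trans (chartDiffeo (IC n k) (legendre L v)).symm),
    ⟨hv, hyR, ?_⟩, fun u hu => heq u hu.1, fun α hα => hα.1.1⟩
  have h := (extChartAt (IC n k) (legendre L v)).map_source (mem_extChartAt_source (legendre L v))
  rw [extChartAt_cov_legendre hL hv] at h
  have h2 : R y = localLegendre l y := hR y
  change R y ∈ (extChartAt (IC n k) (legendre L v)).target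
  rw [h2]
  exact h

end Regular

/-! ### The Lagrangian-Hamiltonian correspondence -/

section Correspondence

variable {n k : ℕ} {Q : Type*} [TopologicalSpace Q] [ChartedSpace (Mdl n) Q]
  [IsManifold (𝓡 n) ∞ Q] {L : T1 n k Q → ℝ}
  {Φ : PartialDiffeomorph (IV n k) (IC n k) (T1 n k Q) (T1s n k Q) ∞}

theorem mfderiv_eq_legendre (hΦ : EqOn Φ (legendre L) Φ.source) {v : T1 n k Q}
    (hv : v ∈ Φ.source) :
    (mfderiv (IV n k) (IC n k) Φ v : VelModel n k →L[ℝ] PhaseModel n k) =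
      mfderiv (IV n k) (IC n k) (legendre L) v :=
  (hΦ.eventuallyEq_of_mem (Φ.open_source.mem_nhds hv)).mfderiv_eq

theorem isLegendreRelated_iff (hΦ : EqOn Φ (legendre L) Φ.source)
    {XL : KVectorField (IV n k) (T1 n k Q) k} {XH : KVectorField (IC n k) (T1s n k Q) k} :
    IsLegendreRelated L XL XH Φ.source ↔
      ∀ v ∈ Φ.source, ∀ A, mfderiv (IV n k) (IC n k) Φ v (XL A v) = XH A (Φ v) := by
  refine forall₃_congr fun v hv A => ?_
  have h1 : (mfderiv (IV n k) (IC n k) Φ v (XL A v) : PhaseModel n k) =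
      mfderiv (IV n k) (IC n k) (legendre L) v (XL A v) :=
    DFunLike.congr_fun (mfderiv_eq_legendre hΦ hv) (XL A v)
  have h2 : ∀ α β : T1s n k Q, α = β → (XH A α : PhaseModel n k) = XH A β := by
    rintro α _ rfl; rfl
  have h3 := h2 _ _ (hΦ hv)
  constructor
  · intro h
    exact h1.trans (h.trans h3.symm)
  · intro h
    exact h1.symm.trans (h.trans h3)

theorem surjective_mfderiv_legendre (hΦ : EqOn Φ (legendre L) Φ.source) {v : T1 n k Q}
    (hv : v ∈ Φ.source) : Function.Surjective (mfderiv (IV n k) (IC n k) (legendre L) v) := by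
  have h := surjective_mfderiv_partialDiffeomorph Φ hv
  intro w
  obtain ⟨u, hu⟩ := h w
  exact ⟨u, (DFunLike.congr_fun (mfderiv_eq_legendre hΦ hv) u).symm.trans hu⟩

theorem contMDiffOn_hamiltonian (hL : ContMDiff (IV n k) 𝓘(ℝ, ℝ) ∞ L)
    (hΦ : EqOn Φ (legendre L) Φ.source) {H : T1s n k Q → ℝ}
    (hH : ∀ v ∈ Φ.source, H (legendre L v) = energy L v) :
    ContMDiffOn (IC n k) 𝓘(ℝ, ℝ) ∞ H Φ.target := by
  refine ((contMDiff_energy hL).comp_contMDiffOn Φ.contMDiffOn_invFun).congr fun α hα => ?_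
  have h := hH _ (Φ.map_target hα)
  rwa [← hΦ (Φ.map_target hα), Φ.right_inv hα] at h

/-- `k`-vector fields related by the Legendre map solve the Lagrangian and the Hamiltonian equation
simultaneously. -/
theorem isSolution_iff_of_legendreRelated (hL : ContMDiff (IV n k) 𝓘(ℝ, ℝ) ∞ L)
    (hΦ : EqOn Φ (legendre L) Φ.source) {H : T1s n k Q → ℝ}
    (hH : ∀ v ∈ Φ.source, H (legendre L v) = energy L v)
    {XL : KVectorField (IV n k) (T1 n k Q) k} {XH : KVectorField (IC n k) (T1s n k Q) k}
    (hX : IsLegendreRelated L XL XH Φ.source) :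
    IsLagrangianSolution L XL Φ.source ↔ IsHamiltonianSolution H XH Φ.target := by
  refine and_congr (isSmoothOn_iff_of_related Φ ((isLegendreRelated_iff hΦ).1 hX)) ?_
  refine solvesOn_iff_of_related (f := legendre L) Φ.open_source
    (hΦ.image_eq.symm.trans Φ.image_source_eq_target)
    (fun v _ => (contMDiff_legendre hL).mdifferentiableAt (by simp))
    (fun α hα => ((contMDiffOn_hamiltonian hL hΦ hH).contMDiffAt
      (Φ.open_target.mem_nhds hα)).mdifferentiableAt (by simp))
    (fun v hv => surjective_mfderiv_legendre hΦ hv)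
    (fun v _ A => omegaL_eq_pullback hL A v) hH hX

/-- The Lagrangian equation is solvable where the Legendre map is a diffeomorphism onto a subset of
a Darboux chart: the chart composed with `FL` gives Darboux coordinates for the `(ω_L)_A`. -/
theorem exists_isLagrangianSolution (hk : 1 ≤ k) (hL : ContMDiff (IV n k) 𝓘(ℝ, ℝ) ∞ L)
    (hΦ : EqOn Φ (legendre L) Φ.source) {α : T1s n k Q}
    (hα : Φ.target ⊆ (extChartAt (IC n k) α).source) :
    ∃ XL : KVectorField (IV n k) (T1 n k Q) k, IsLagrangianSolution L XL Φ.source := by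
  let Ψ := Φ.trans (chartDiffeo (IC n k) α)
  have hs : Ψ.source = Φ.source := by
    refine Subset.antisymm (fun v hv => hv.1) fun v hv => ⟨hv, ?_⟩
    exact hα (Φ.map_source hv)
  have h := exists_solution_of_darboux hk Ψ (w := omegaL L) (e := energy L) (fun v hv A => ?_)
    (contMDiff_energy hL).contMDiffOn
  · rwa [hs] at h
  · rw [hs] at hv
    have hsrc : legendre L v ∈ (extChartAt (IC n k) α).source :=
      hΦ hv ▸ hα (Φ.map_source hv)
    have h1 : Ψ =ᶠ[𝓝 v] extChartAt (IC n k) α ∘ legendre L := by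
      filter_upwards [Φ.open_source.mem_nhds hv] with u hu
      exact congrArg (extChartAt (IC n k) α) (hΦ hu)
    have h2 : mfderiv (IV n k) 𝓘(ℝ, PhaseModel n k) Ψ v =
        (mfderiv (IC n k) 𝓘(ℝ, PhaseModel n k) (extChartAt (IC n k) α) (legendre L v)).comp
          (mfderiv (IV n k) (IC n k) (legendre L) v) :=
      h1.mfderiv_eq.trans (mfderiv_comp v
        (mdifferentiableAt_extChartAt (by rwa [extChartAt_source] at hsrc))
        ((contMDiff_legendre hL).mdifferentiableAt (by simp)))
    have h3 : Ψ v = extChartAt (IC n k) α (legendre L v) := h1.self_of_nhds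
    rw [omegaL_eq_pullback hL, omega0_eq_pullback A hsrc, h2]
    refine ContinuousAlternatingMap.ext fun u => ?_
    have h4 : ∀ y y' : PhaseModel n k, y = y' → ∀ u, omegaModel A y u = omegaModel A y' u := by
      rintro y _ rfl u; rfl
    exact (h4 _ _ h3 _).symm

end Correspondence

end KSymplectic

theorem mainTheorem10 {n k : ℕ} (hk : 1 ≤ k)
    {Q : Type*} [TopologicalSpace Q] [T2Space Q] [ParacompactSpace Q] [ConnectedSpace Q]
    [ChartedSpace (Mdl n) Q] [IsManifold (𝓡 n) ∞ Q]
    (L : T1 n k Q → ℝ) (hL : ContMDiff (IV n k) 𝓘(ℝ, ℝ) ∞ L) (hreg : IsRegularLagrangian L) :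
    (∀ v : T1 n k Q, ∃ Φ : PartialDiffeomorph (IV n k) (IC n k) (T1 n k Q) (T1s n k Q) ∞,
      v ∈ Φ.source ∧ EqOn Φ (legendre L) Φ.source ∧
      ∃ XL : KVectorField (IV n k) (T1 n k Q) k, IsLagrangianSolution L XL Φ.source) ∧
    (∀ Φ : PartialDiffeomorph (IV n k) (IC n k) (T1 n k Q) (T1s n k Q) ∞,
      EqOn Φ (legendre L) Φ.source →
      ∀ H : T1s n k Q → ℝ, (∀ v ∈ Φ.source, H (legendre L v) = energy L v) →
        ContMDiffOn (IC n k) 𝓘(ℝ, ℝ) ∞ H Φ.target ∧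
        (∀ XL : KVectorField (IV n k) (T1 n k Q) k, IsLagrangianSolution L XL Φ.source →
          (∃ XH : KVectorField (IC n k) (T1s n k Q) k, IsLegendreRelated L XL XH Φ.source) ∧
          ∀ XH : KVectorField (IC n k) (T1s n k Q) k, IsLegendreRelated L XL XH Φ.source →
            IsHamiltonianSolution H XH Φ.target) ∧
        (∀ XH : KVectorField (IC n k) (T1s n k Q) k, IsHamiltonianSolution H XH Φ.target →
          IsIntegrableOn (IC n k) XH Φ.target →
          ∃ Z : KVectorField (IW n k) (W n k Q) k,
            IsUnifiedSolution L Z Φ.source ∧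
            IsIntegrableOn (IW n k) Z (graphSet L ∩ pr1 ⁻¹' Φ.source) ∧
            ∃ XL : KVectorField (IV n k) (T1 n k Q) k,
              IsProjectionOf L XL Z Φ.source ∧
              IsLagrangianSolution L XL Φ.source ∧
              IsLegendreRelated L XL XH Φ.source)) := by
  refine ⟨fun v => ?_, fun Φ hΦ H hH => ⟨contMDiffOn_hamiltonian hL hΦ hH, fun XL hXL => ⟨?_,
    fun XH hX => (isSolution_iff_of_legendreRelated hL hΦ hH hX).1 hXL⟩, fun XH hXH hint => ?_⟩⟩
  · obtain ⟨Φ, hv, hΦ, ht⟩ := exists_partialDiffeomorph_legendre hL hreg v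
    exact ⟨Φ, hv, hΦ, exists_isLagrangianSolution hk hL hΦ ht⟩
  · obtain ⟨XH, hXH⟩ := exists_related Φ.symm XL
    exact ⟨XH, (isLegendreRelated_iff hΦ).2 (related_symm Φ.symm hXH)⟩
  · obtain ⟨XL, hX⟩ := exists_related Φ XH
    have hrel := (isLegendreRelated_iff hΦ).2 hX
    have hXL := (isSolution_iff_of_legendreRelated hL hΦ hH hrel).2 hXH
    have hsurj := fun v hv => surjective_mfderiv_legendre (v := v) hΦ hv
    let Z : KVectorField (IW n k) (W n k Q) k := fun A z =>
      (mfderiv (IV n k) (IW n k) (graphMap L) (pr1 z) (XL A (pr1 z)) : WhitneyModel n k)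
    have hXZ : ∀ v ∈ Φ.source, ∀ A,
        mfderiv (IV n k) (IW n k) (graphMap L) v (XL A v) = Z A (graphMap L v) :=
      fun v _ A => rfl
    have hgraph := contMDiff_graphMap hL
    have hto : MapsTo (graphMap L) Φ.source (graphSet L ∩ pr1 ⁻¹' Φ.source) :=
      fun v hv => ⟨rfl, hv⟩
    have hon : SurjOn (graphMap L) Φ.source (graphSet L ∩ pr1 ⁻¹' Φ.source) :=
      fun z hz => ⟨pr1 z, hz.2, eq_graphMap_pr1 hz.1⟩
    refine ⟨Z, ⟨?_, fun v _ A => ⟨XL A v, rfl⟩, solvesOn_graph hL hsurj hXL.2 hXZ⟩, ?_,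
      XL, ?_, hXL, hrel⟩
    · exact hXL.1.map Φ.open_source hgraph.contMDiffOn contMDiff_pr1.contMDiffOn
        (fun z hz => hz.2) (fun z hz => eq_graphMap_pr1 hz.1) hXZ
    · have hintL : IsIntegrableOn (IV n k) XL Φ.source :=
        hint.map Φ.open_target Φ.contMDiffOn_invFun Φ.mapsTo_symm
          (fun v hv => ⟨Φ v, Φ.map_source hv, Φ.left_inv hv⟩) (related_symm Φ hX)
      exact hintL.map Φ.open_source hgraph.contMDiffOn hto hon hXZ
    · rintro z ⟨hz, hzU⟩ A
      obtain ⟨v, rfl⟩ : ∃ v, graphMap L v = z := ⟨pr1 z, eq_graphMap_pr1 hz⟩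
      exact (mfderiv_pr1_graphMap hL v (XL A v)).symm
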